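/- Let $\Sigma_+=\{\Im z>1\}$, $\Sigma_c=\{|\Im z|<1\}$, $\Sigma_-=\{\Im z<-1\}$. For $\varepsilon\in\mathbb R$ and complex polynomials $h^+,h^c,h^-$, consider the piecewise polynomial holomorphic system $$\dot z=iz+\varepsilon h^{\sigma}(z),\qquad z\in\Sigma_\sigma,\quad \sigma\in\{+,c,-\},$$ with the dynamics on the lines $\Im z=\pm1$ given by Filippov's convention: solutions are the locally absolutely continuous curves $z(t)$ with $\dot z(t)=i z(t)+\varepsilon h^\sigma(z(t))$ while $z(t)\in\Sigma_\sigma$, and with $\dot z(t)$ in the segment joining the two adjacent fields at $z(t)$ when $z(t)$ lies on one of the lines, for almost every $t$. A limit cycle is a simple closed periodic orbit $\Gamma$ that has a neighbourhood containing no other periodic orbit. For $\varepsilon=0$ the system is the linear center $\dot z=iz$, whose periodic orbits that cross both lines are the circles $|z|=r$ with $r>1$. There exist polynomials $h^+,h^c,h^-$ of degree $4$, radii $1<r_1<r_2<r_3<r_4$ and $\varepsilon_0>0$ such that for every real $\varepsilon$ with $0<|\varepsilon|<\varepsilon_0$ the system has four distinct limit cycles $\Gamma_1(\varepsilon),\dots,\Gamma_4(\varepsilon)$,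 and for each $k$ the limit cycle $\Gamma_k(\varepsilon)$ converges to the circle $|z|=r_k$ in the Hausdorff distance as $\varepsilon\to0$. That is, for suitable coefficients, at least $4$ limit cycles bifurcate from the periodic orbits of the center that cross both lines. -/

import Mathlib

/-- The three zones `Im z > 1`, `|Im z| < 1` and `Im z < -1`. -/
inductive Zone
  | plus
  | center
  | minus

/-- The set-valued right-hand side that Filippov's convention attaches to the planar piecewise
smooth system `z' = X σ z` on zone `σ`: inside a zone it is the single vector given by the field of
that zone; on a separating line it is the segment spanned by the two adjacent fields, that is, the
convex hull of the limits of the piecewise field at that point. -/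
noncomputable def filippov (X : Zone → ℂ → ℂ) (z : ℂ) : Set ℂ :=
  if 1 < z.im then {X .plus z}
  else if z.im = 1 then segment ℝ (X .plus z) (X .center z)
  else if -1 < z.im then {X .center z}
  else if z.im = -1 then segment ℝ (X .center z) (X .minus z)
  else {X .minus z}

/-- A solution, defined for all times, of the differential inclusion `z' ∈ F z`: a locally
absolutely continuous curve whose derivative exists and lies in `F` at almost every time. -/
def IsSolution (F : ℂ → Set ℂ) (γ : ℝ → ℂ) : Prop :=
  (∀ a b : ℝ, AbsolutelyContinuousOnInterval γ a b) ∧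
    ∀ᵐ t : ℝ, ∃ v ∈ F (γ t), HasDerivAt γ v t

/-- A periodic orbit: the trace of a nonconstant periodic solution. -/
def IsPeriodicOrbit (F : ℂ → Set ℂ) (Γ : Set ℂ) : Prop :=
  ∃ (γ : ℝ → ℂ) (T : ℝ), IsSolution F γ ∧ 0 < T ∧ Function.Periodic γ T ∧
    (∃ s t : ℝ, γ s ≠ γ t) ∧ Γ = Set.range γ

/-- A periodic orbit that is a simple closed curve, run through exactly once in a period. -/
def IsSimplePeriodicOrbit (F : ℂ → Set ℂ) (Γ : Set ℂ) : Prop :=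
  ∃ (γ : ℝ → ℂ) (T : ℝ), IsSolution F γ ∧ 0 < T ∧ Function.Periodic γ T ∧
    Set.InjOn γ (Set.Ico 0 T) ∧ Γ = Set.range γ

/-- A limit cycle: a simple periodic orbit which is isolated, i.e. which has a neighbourhood
that contains no other periodic orbit. -/
def IsLimitCycle (F : ℂ → Set ℂ) (Γ : Set ℂ) : Prop :=
  IsSimplePeriodicOrbit F Γ ∧
    ∃ U : Set ℂ, IsOpen U ∧ Γ ⊆ U ∧ ∀ Γ' : Set ℂ, IsPeriodicOrbit F Γ' → Γ' ⊆ U → Γ' = Γ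

/-- The piecewise polynomial holomorphic perturbation `z' = i z + ε h^σ(z)` of the linear center. -/
noncomputable def perturbedCenter (h : Zone → Polynomial ℂ) (ε : ℝ) (σ : Zone) (z : ℂ) : ℂ :=
  Complex.I * z + (ε : ℂ) * (h σ).eval z

/-! # Four limit cycles of a piecewise polynomial holomorphic system with two switching lines

The system is studied in the logarithmic coordinate `w = log z`, where the field of each zone
becomes `w' = i + ε g w` with the entire function `g = logField h`, and the circles of the
unperturbed center become vertical lines, cut four times per turn by the curves `Im w = cut j (Re
w)` over which the zones change. A holomorphic field can be straightened: a primitive of `i / (i +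
ε g)` is a flow coordinate `H = w + i ε (A w + O(ε))`, with `A` a primitive of `g`, along which
solutions move with velocity `i` (`exists_isFlowCoordinate`). So `Re H` is a first integral and an
orbit arc joins two consecutive cuts exactly if its end points have the same `Re H`. With `x j` the
logarithmic radius at the `j`-th crossing, these conditions read `x (j + 1) - x j = ε (b j (x (j +
1)) - a j (x j))` (`IsCrossingChain`), and the change of radius over one turn is, to first order,
`ε` times the Melnikov function `melnikov A`, the sum of the increments of `Im A` along the four
arcs of a circle.

Near a simple zero of `melnikov A`, with derivative `m`, the difference of two chains is multiplied
over a turn by `1 + ε m` up to a small relative error (`IsCrossingChain.sub_estimate`). This yields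
a closed chain (`exists_closed_isCrossingChain`), and also its isolation: a two-sided sequence of
consecutive chains that remains near the zero must be constant, because a bounded sequence cannot
follow a hyperbolic recursion unless it vanishes (`eq_zero_of_hyperbolic_recursion`).

Every Filippov solution that stays in a thin annulus lifts to the logarithmic plane
(`IsFrame.exists_lift`). Its velocity is close to `i` even on the switching lines, since the
Filippov set is a convex hull, so its phase with respect to each cut strictly increases
(`IsFrame.phase_growth`); it therefore crosses each cut once per turn and gives a two-sided
sequence of chains. Hence all such solutions trace the same set (`IsFrame.range_eq_orbitSet`),
without any appeal to uniqueness for the differential inclusion. Conversely the closed chain is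
traced by an actual simple periodic solution, glued from four arcs
(`IsFrame.exists_periodic_solution`). Together these give a limit cycle for each simple zero
(`exists_isLimitCycle_of_simple_zero`), within `O(ε)` of the circle.

It remains to find quartics whose Melnikov function has four simple zeros. In terms of the abscissa
`X > 0` at which the circle meets the line `Im z = 1`, the monomials contribute combinations of
`1`, `X / (1 + X²)`, `X` and `X³`, and `fourCyclePerturbation` combines them so that the zeros are
`X = 1, 2, 9/2, 11/2` (`exists_melnikov_simple_zero`).
-/

open Set MeasureTheory Filter Topology
open scoped NNReal

/-! ### Lipschitz curves and their derivatives -/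

/-- A locally absolutely continuous curve whose velocity is almost everywhere bounded by `C` is
`C`-Lipschitz. -/
theorem lipschitzWith_of_absolutelyContinuous {γ : ℝ → ℂ} {C : ℝ≥0}
    (hγ : ∀ a b : ℝ, AbsolutelyContinuousOnInterval γ a b)
    (hd : ∀ᵐ t : ℝ, ∃ v : ℂ, ‖v‖ ≤ C ∧ HasDerivAt γ v t) : LipschitzWith C γ := by
  have hb : ∀ᵐ t : ℝ, ‖deriv γ t‖ ≤ C := by
    filter_upwards [hd] with t ⟨v, hv, h⟩
    rwa [h.deriv]
  have hm : AEStronglyMeasurable (deriv γ) volume :=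
    (stronglyMeasurable_deriv γ).aestronglyMeasurable
  have hint : ∀ a b : ℝ, IntervalIntegrable (deriv γ) volume a b := fun a b =>
    (intervalIntegrable_const (c := (C : ℝ))).mono_fun hm.restrict
      (by
        refine ae_restrict_of_ae ?_
        filter_upwards [hb] with t ht
        simpa using ht)
  have hloc : LocallyIntegrable (deriv γ) volume := by
    refine (locallyIntegrable_const (C : ℝ)).mono hm ?_
    filter_upwards [hb] with t ht
    simpa using ht
  have hbd : ∀ a b : ℝ, ‖∫ t in a..b, deriv γ t‖ ≤ C * |b - a| := fun a b =>
    intervalIntegral.norm_integral_le_of_norm_le_const_ae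
      (by filter_upwards [hb] with t ht _ using ht)
  refine LipschitzWith.of_dist_le_mul fun b a => ?_
  have hlip : LipschitzWith C fun x => ∫ t in a..x, deriv γ t := by
    refine LipschitzWith.of_dist_le_mul fun x y => ?_
    rw [dist_eq_norm, intervalIntegral.integral_interval_sub_left (hint _ _) (hint _ _),
      Real.dist_eq]
    exact hbd _ _
  have hac := (hγ a b).sub (hlip.lipschitzOnWith (s := uIcc a b)).absolutelyContinuousOnInterval
  obtain ⟨c, hc⟩ := hac.const_of_ae_hasDerivAt_zero (by
    filter_upwards [hd, _root_.LocallyIntegrable.ae_hasDerivAt_integral hloc] with t ⟨v, _, hv⟩ h2 _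
    have := hv.sub (h2 a)
    rwa [hv.deriv, sub_self] at this)
  have h1 := hc a left_mem_uIcc
  have h2 := hc b right_mem_uIcc
  simp only [Pi.sub_apply, intervalIntegral.integral_same, sub_zero] at h1 h2
  rw [dist_eq_norm, Real.dist_eq, show γ b - γ a = ∫ t in a..b, deriv γ t by
    rw [h1, ← h2]; ring]
  exact hbd a b

/-- A Lipschitz function grows at least at any rate that bounds its almost everywhere derivative
from below. -/
theorem mul_sub_le_of_ae_le_deriv {f : ℝ → ℝ} {K : ℝ≥0} {a b c : ℝ} (hab : a ≤ b)
    (hf : LipschitzOnWith K f (Icc a b))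
    (hd : ∀ᵐ t : ℝ, t ∈ Ioo a b → ∃ v : ℝ, c ≤ v ∧ HasDerivAt f v t) :
    c * (b - a) ≤ f b - f a := by
  rw [← uIcc_of_le hab] at hf
  have hac := hf.absolutelyContinuousOnInterval
  rw [← hac.integral_deriv_eq_sub]
  have : ∫ _ in a..b, c = c * (b - a) := by simp [mul_comm]
  rw [← this]
  refine intervalIntegral.integral_mono_ae_restrict hab (by simp) hac.intervalIntegrable_deriv ?_
  have hne : ∀ᵐ t : ℝ, t ≠ a ∧ t ≠ b := by
    have h1 : ∀ᵐ t : ℝ, t ≠ a := by simp [ae_iff, measure_singleton]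
    have h2 : ∀ᵐ t : ℝ, t ≠ b := by simp [ae_iff, measure_singleton]
    exact h1.and h2
  refine (ae_restrict_iff' measurableSet_Icc).2 ?_
  filter_upwards [hd, hne] with t ht hne hmem
  obtain ⟨v, hv, h⟩ := ht ⟨lt_of_le_of_ne hmem.1 hne.1.symm, lt_of_le_of_ne hmem.2 hne.2⟩
  rwa [h.deriv]

/-- A Lipschitz curve with almost everywhere constant velocity is affine. -/
theorem eq_add_mul_of_ae_hasDerivAt_const {f : ℝ → ℂ} {K : ℝ≥0} {a b : ℝ} {c : ℂ}
    (hf : LipschitzOnWith K f (Icc a b))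
    (hd : ∀ᵐ t : ℝ, t ∈ Ioo a b → HasDerivAt f c t) {t : ℝ} (ht : t ∈ Icc a b) :
    f t = f a + c * ((t - a : ℝ) : ℂ) := by
  have hab : a ≤ b := ht.1.trans ht.2
  rw [← uIcc_of_le hab] at hf
  have hl : LipschitzWith ‖c‖₊ fun t : ℝ => c * (t : ℂ) := by
    refine LipschitzWith.of_dist_le_mul fun x y => ?_
    rw [dist_eq_norm, ← mul_sub, norm_mul, ← Complex.ofReal_sub, Complex.norm_real]
    rfl
  have hac := hf.absolutelyContinuousOnInterval.sub
    (hl.lipschitzOnWith (s := uIcc a b)).absolutelyContinuousOnInterval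
  have hne : ∀ᵐ t : ℝ, t ≠ a ∧ t ≠ b := by
    have h1 : ∀ᵐ t : ℝ, t ≠ a := by simp [ae_iff, measure_singleton]
    have h2 : ∀ᵐ t : ℝ, t ≠ b := by simp [ae_iff, measure_singleton]
    exact h1.and h2
  obtain ⟨k, hk⟩ := hac.const_of_ae_hasDerivAt_zero (by
    filter_upwards [hd, hne] with t ht hne hmem
    rw [uIcc_of_le hab] at hmem
    have h := ht ⟨lt_of_le_of_ne hmem.1 hne.1.symm, lt_of_le_of_ne hmem.2 hne.2⟩
    have h2 : HasDerivAt (fun t : ℝ => c * (t : ℂ)) c t := by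
      simpa using (Complex.ofRealCLM.hasDerivAt (x := t)).const_mul c
    simpa using h.sub h2)
  have h1 := hk a left_mem_uIcc
  have h2 := hk t (by rwa [uIcc_of_le hab])
  simp only [Pi.sub_apply] at h1 h2
  push_cast
  linear_combination h2 - h1

/-- A Lipschitz curve in the punctured plane has a Lipschitz logarithm along it as soon as its
logarithmic velocity is bounded. -/
theorem exists_log_lift {γ : ℝ → ℂ} {K C : ℝ≥0} (hγ : LipschitzWith K γ) (h0 : ∀ t, γ t ≠ 0)
    (hd : ∀ᵐ t : ℝ, ∃ v : ℂ, ‖v‖ ≤ C ∧ HasDerivAt γ (γ t * v) t) :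
    ∃ w : ℝ → ℂ, LipschitzWith C w ∧ (∀ t, Complex.exp (w t) = γ t) ∧
      ∀ᵐ t : ℝ, ∃ v : ℂ, HasDerivAt γ (γ t * v) t ∧ HasDerivAt w v t := by
  set u : ℝ → ℂ := fun t => deriv γ t / γ t with hu
  have hb : ∀ᵐ t : ℝ, ‖u t‖ ≤ C := by
    filter_upwards [hd] with t ⟨v, hv, h⟩
    simp only [hu]
    rwa [h.deriv, mul_div_cancel_left₀ _ (h0 t)]
  have hm : AEStronglyMeasurable u volume :=
    ((stronglyMeasurable_deriv γ).div hγ.continuous.stronglyMeasurable).aestronglyMeasurable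
  have hint : ∀ a b : ℝ, IntervalIntegrable u volume a b := fun a b =>
    (intervalIntegrable_const (c := (C : ℝ))).mono_fun hm.restrict
      (by
        refine ae_restrict_of_ae ?_
        filter_upwards [hb] with t ht
        simpa using ht)
  have hloc : LocallyIntegrable u volume := by
    refine (locallyIntegrable_const (C : ℝ)).mono hm ?_
    filter_upwards [hb] with t ht
    simpa using ht
  set w : ℝ → ℂ := fun x => Complex.log (γ 0) + ∫ t in (0 : ℝ)..x, u t with hw
  have hlip : LipschitzWith C w := by
    refine LipschitzWith.of_dist_le_mul fun x y => ?_
    rw [dist_eq_norm, hw, add_sub_add_left_eq_sub,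
      intervalIntegral.integral_interval_sub_left (hint _ _) (hint _ _), Real.dist_eq]
    exact intervalIntegral.norm_integral_le_of_norm_le_const_ae
      (by filter_upwards [hb] with t ht _ using ht)
  have hdw : ∀ᵐ t : ℝ, ∃ v : ℂ, HasDerivAt γ (γ t * v) t ∧ HasDerivAt w v t := by
    filter_upwards [hd, _root_.LocallyIntegrable.ae_hasDerivAt_integral hloc] with t ⟨v, _, h⟩ h2
    refine ⟨v, h, ?_⟩
    have := (h2 0).const_add (Complex.log (γ 0))
    simp only [hu] at this
    rwa [h.deriv, mul_div_cancel_left₀ _ (h0 t)] at this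
  refine ⟨w, hlip, fun b => ?_, hdw⟩
  -- The curve `exp (-w) * γ` is absolutely continuous with vanishing derivative.
  obtain ⟨R, hR⟩ := (isCompact_uIcc (a := (0 : ℝ)) (b := b)).exists_bound_of_continuousOn
    hlip.continuous.continuousOn
  obtain ⟨L, hL⟩ := (Complex.contDiff_exp (𝕜 := ℝ) (n := 1)).contDiffOn.exists_lipschitzOnWith
    (by decide) (convex_closedBall (0 : ℂ) R) (isCompact_closedBall _ _)
  have hexp : LipschitzOnWith (L * C) (fun t => Complex.exp (-w t)) (uIcc 0 b) :=
    hL.comp (s := uIcc 0 b) hlip.neg.lipschitzOnWith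
      (fun t ht => by simpa using hR t ht)
  have hac := hexp.absolutelyContinuousOnInterval.smul
    (hγ.lipschitzOnWith (s := uIcc 0 b)).absolutelyContinuousOnInterval
  obtain ⟨k, hk⟩ := hac.const_of_ae_hasDerivAt_zero (by
    filter_upwards [hdw] with t ⟨v, h1, h2⟩ _
    have := (h2.neg.cexp).mul h1
    refine this.congr_deriv ?_
    simp only [Pi.neg_apply]
    ring)
  have h1 := hk 0 left_mem_uIcc
  have h2 := hk b right_mem_uIcc
  have hw0 : Complex.exp (w 0) = γ 0 := by simp [hw, Complex.exp_log (h0 0)]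
  simp only [Pi.smul_apply', smul_eq_mul, Complex.exp_neg, hw0, inv_mul_cancel₀ (h0 0)] at h1 h2
  rw [← h1] at h2
  exact ((inv_mul_eq_one₀ (Complex.exp_ne_zero _)).1 h2)

/-! ### Polar description of the zones and of the Filippov field -/

/-- The angles at which the circle of radius `exp ρ` meets the lines `Im z = ±1`, in increasing
order along one turn that starts on `Im z = 1`, `Re z > 0`; index `4` repeats index `0` one turn
later. Larger indices play no role. -/
noncomputable def cut : ℕ → ℝ → ℝ
  | 0, ρ => Real.arcsin (Real.exp (-ρ))
  | 1, ρ => Real.pi - Real.arcsin (Real.exp (-ρ))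
  | 2, ρ => Real.pi + Real.arcsin (Real.exp (-ρ))
  | 3, ρ => 2 * Real.pi - Real.arcsin (Real.exp (-ρ))
  | _, ρ => 2 * Real.pi + Real.arcsin (Real.exp (-ρ))

/-- The zone that a circle visits between its `j`-th and `(j+1)`-st intersection with the lines
`Im z = ±1`, for `j < 4`. -/
def zoneAt : ℕ → Zone
  | 0 => .plus
  | 2 => .minus
  | _ => .center

theorem arcsin_exp_neg_pos (ρ : ℝ) : 0 < Real.arcsin (Real.exp (-ρ)) :=
  Real.arcsin_pos.2 (Real.exp_pos _)

theorem arcsin_exp_neg_lt {ρ : ℝ} (hρ : 0 < ρ) :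
    Real.arcsin (Real.exp (-ρ)) < Real.pi / 2 :=
  Real.arcsin_lt_pi_div_two.2 (by simpa using hρ)

/-- Consecutive cuts are ordered, even when evaluated at different radii. -/
theorem cut_lt_cut {j : ℕ} (hj : j < 4) {x y : ℝ} (hx : 0 < x) (hy : 0 < y) :
    cut j x < cut (j + 1) y := by
  have := arcsin_exp_neg_pos x
  have := arcsin_exp_neg_pos y
  have := arcsin_exp_neg_lt hx
  have := arcsin_exp_neg_lt hy
  interval_cases j <;> simp only [cut] <;> linarith

theorem cut_pos {j : ℕ} (hj : j ≤ 4) {x : ℝ} (hx : 0 < x) : 0 < cut j x := by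
  have := arcsin_exp_neg_pos x
  have := arcsin_exp_neg_lt hx
  interval_cases j <;> simp only [cut] <;> linarith

theorem cut_le {j : ℕ} (hj : j ≤ 4) {x : ℝ} (hx : 0 < x) : cut j x ≤ 5 * Real.pi / 2 := by
  have := arcsin_exp_neg_pos x
  have := arcsin_exp_neg_lt hx
  interval_cases j <;> simp only [cut] <;> linarith

theorem cut_four (x : ℝ) : cut 4 x = cut 0 x + 2 * Real.pi := by
  simp only [cut]; ring

theorem contDiffAt_cut {j : ℕ} (hj : j ≤ 4) {x : ℝ} (hx : 0 < x) : ContDiffAt ℝ 1 (cut j) x := by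
  have h : ContDiffAt ℝ 1 (fun ρ : ℝ => Real.arcsin (Real.exp (-ρ))) x := by
    refine (Real.contDiffAt_arcsin ?_ ?_).comp x (by fun_prop)
    · linarith [Real.exp_pos (-x)]
    · exact (by simpa using hx : Real.exp (-x) < 1).ne
  interval_cases j
  · exact h
  · exact contDiffAt_const.sub h
  · exact contDiffAt_const.add h
  · exact contDiffAt_const.sub h
  · exact contDiffAt_const.add h

/-- Between two consecutive cuts the Filippov field is the single field of the zone. -/
theorem filippov_exp {X : Zone → ℂ → ℂ} {j : ℕ} (hj : j < 4) {w : ℂ} (hw : 0 < w.re)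
    (h1 : cut j w.re < w.im) (h2 : w.im < cut (j + 1) w.re) :
    filippov X (Complex.exp w) = {X (zoneAt j) (Complex.exp w)} := by
  set α := Real.arcsin (Real.exp (-w.re)) with hα
  have hα0 : 0 < α := arcsin_exp_neg_pos _
  have hα1 : α < Real.pi / 2 := arcsin_exp_neg_lt hw
  have hsin : Real.sin α = Real.exp (-w.re) :=
    Real.sin_arcsin (by linarith [Real.exp_pos (-w.re)]) (by simpa using hw.le)
  have him : (Complex.exp w).im = Real.exp w.re * Real.sin w.im := Complex.exp_im w
  have hone : Real.exp w.re * Real.sin α = 1 := by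
    rw [hsin, ← Real.exp_add]; simp
  have hE := Real.exp_pos w.re
  -- On an interval of length at most `π` about the top of the sine, it exceeds its end values.
  have key : ∀ x : ℝ, α < x → x < Real.pi - α → Real.sin α < Real.sin x := by
    intro x hx1 hx2
    rcases le_or_gt x (Real.pi / 2) with h | h
    · exact Real.sin_lt_sin_of_lt_of_le_pi_div_two (by linarith) h hx1
    · rw [← Real.sin_pi_sub x]
      exact Real.sin_lt_sin_of_lt_of_le_pi_div_two (by linarith) (by linarith) (by linarith)
  have key2 : ∀ x : ℝ, -α < x → x < α → |Real.sin x| < Real.sin α := by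
    intro x hx1 hx2
    rw [abs_lt]
    constructor
    · rw [← Real.sin_neg]
      exact Real.sin_lt_sin_of_lt_of_le_pi_div_two (by linarith) (by linarith) hx1
    · exact Real.sin_lt_sin_of_lt_of_le_pi_div_two (by linarith) (by linarith) hx2
  have hcenter : |Real.sin w.im| < Real.sin α →
      filippov X (Complex.exp w) = {X .center (Complex.exp w)} := by
    intro h
    rw [abs_lt] at h
    have h3 : (Complex.exp w).im < 1 := by rw [him, ← hone]; nlinarith
    have h4 : -1 < (Complex.exp w).im := by rw [him, ← hone]; nlinarith
    simp [filippov, h3.not_gt, h3.ne, h4]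
  interval_cases j <;> simp only [cut, ← hα, zoneAt] at *
  · have h3 : 1 < (Complex.exp w).im := by
      rw [him, ← hone]
      exact mul_lt_mul_of_pos_left (key _ h1 h2) hE
    simp [filippov, h3]
  · apply hcenter
    rw [← abs_neg, ← Real.sin_sub_pi]
    exact key2 _ (by linarith) (by linarith)
  · have h3 : (Complex.exp w).im < -1 := by
      have := mul_lt_mul_of_pos_left (key (w.im - Real.pi) (by linarith) (by linarith)) hE
      rw [Real.sin_sub_pi] at this
      rw [him]; linarith
    have h4 : ¬ 1 < (Complex.exp w).im := by linarith
    have h5 : ¬ (Complex.exp w).im = 1 := by linarith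
    have h6 : ¬ -1 < (Complex.exp w).im := by linarith
    simp [filippov, h4, h5, h6, h3.ne]
  · apply hcenter
    rw [← Real.sin_sub_two_pi]
    exact key2 _ (by linarith) (by linarith)

theorem filippov_subset {X : Zone → ℂ → ℂ} {z : ℂ} {s : Set ℂ} (hs : Convex ℝ s)
    (h : ∀ σ, X σ z ∈ s) : filippov X z ⊆ s := by
  unfold filippov
  split_ifs
  · simpa using h _
  · exact hs.segment_subset (h _) (h _)
  · simpa using h _
  · exact hs.segment_subset (h _) (h _)
  · simpa using h _

/-- The perturbation `h` in the logarithmic coordinate `w = log z`: the field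
`z' = i z + ε h z` becomes `w' = i + ε logField h w`. -/
noncomputable def logField (h : Polynomial ℂ) (w : ℂ) : ℂ :=
  Complex.exp (-w) * h.eval (Complex.exp w)

theorem differentiable_logField (h : Polynomial ℂ) : Differentiable ℂ (logField h) := by
  unfold logField
  exact (Complex.differentiable_exp.comp differentiable_neg).mul
    (h.differentiable.comp Complex.differentiable_exp)

theorem perturbedCenter_exp (h : Zone → Polynomial ℂ) (ε : ℝ) (σ : Zone) (w : ℂ) :
    perturbedCenter h ε σ (Complex.exp w) =
      Complex.exp w * (Complex.I + ε * logField (h σ) w) := by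
  have : Complex.exp w * Complex.exp (-w) = 1 := by rw [← Complex.exp_add]; simp
  simp only [perturbedCenter, logField]
  linear_combination (-(ε : ℂ) * (h σ).eval (Complex.exp w)) * this

/-- In the logarithmic coordinate every Filippov velocity is close to `i`. -/
theorem norm_sub_I_le_of_mem_filippov {h : Zone → Polynomial ℂ} {ε κ : ℝ} {w v : ℂ}
    (hκ : ∀ σ, |ε| * ‖logField (h σ) w‖ ≤ κ)
    (hv : Complex.exp w * v ∈ filippov (perturbedCenter h ε) (Complex.exp w)) :
    ‖v - Complex.I‖ ≤ κ := by
  have hpos : 0 < ‖Complex.exp w‖ := norm_pos_iff.2 (Complex.exp_ne_zero _)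
  have hsub := filippov_subset (X := perturbedCenter h ε) (z := Complex.exp w)
    (convex_closedBall (Complex.exp w * Complex.I) (‖Complex.exp w‖ * κ)) (fun σ => by
      rw [perturbedCenter_exp, mem_closedBall_iff_norm, ← mul_sub, norm_mul, add_sub_cancel_left,
        norm_mul, Complex.norm_real, Real.norm_eq_abs]
      gcongr
      exact hκ σ)
  have := hsub hv
  rw [mem_closedBall_iff_norm, ← mul_sub, norm_mul] at this
  exact le_of_mul_le_mul_left this hpos

/-! ### Crossing chains and hyperbolic recursions -/

/-- The crossing equations for one turn of an orbit: `x j` is the logarithmic radius at the `j`-th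
crossing of the lines, and each arc between two crossings changes it by the increment of a
first-order correction with boundary values `a j` (at the start) and `b j` (at the end). -/
def IsCrossingChain (ε : ℝ) (a b : ℕ → ℝ → ℝ) (x : ℕ → ℝ) : Prop :=
  ∀ j < 4, x (j + 1) - x j = ε * (b j (x (j + 1)) - a j (x j))

section Chains

variable {ε η K : ℝ} {a b : ℕ → ℝ → ℝ} {a' b' : ℕ → ℝ} {I : Set ℝ}

/-- A function that is linear up to a small relative error is Lipschitz. -/
theorem abs_sub_le_of_abs_sub_linear_le {f : ℝ → ℝ} {c u v : ℝ} (hc : |c| ≤ K) (hη : η ≤ K)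
    (h : |f u - f v - c * (u - v)| ≤ η * |u - v|) : |f u - f v| ≤ 2 * K * |u - v| := by
  have h1 : |c * (u - v)| ≤ K * |u - v| := by rw [abs_mul]; gcongr
  have h2 : η * |u - v| ≤ K * |u - v| := by gcongr
  have h3 := abs_sub_abs_le_abs_sub (f u - f v) (c * (u - v))
  linarith

/-- The difference of two crossing chains is, after one turn, multiplied by `1 + ε m` up to a small
relative error, where `m` is the derivative of the sum of the increments; in between it changes by a
bounded factor. -/
theorem IsCrossingChain.sub_estimate
    (ha : ∀ j < 4, ∀ u ∈ I, ∀ v ∈ I, |a j u - a j v - a' j * (u - v)| ≤ η * |u - v|)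
    (hb : ∀ j < 4, ∀ u ∈ I, ∀ v ∈ I, |b j u - b j v - b' j * (u - v)| ≤ η * |u - v|)
    (ha' : ∀ j < 4, |a' j| ≤ K) (hb' : ∀ j < 4, |b' j| ≤ K) (hη0 : 0 ≤ η) (hη : η ≤ K)
    (hε : |ε| * K ≤ 1 / 16) {x y : ℕ → ℝ} (hx : IsCrossingChain ε a b x)
    (hy : IsCrossingChain ε a b y) (hxI : ∀ j ≤ 4, x j ∈ I) (hyI : ∀ j ≤ 4, y j ∈ I) :
    (∀ j ≤ 4, |x j - y j| ≤ 3 * |x 0 - y 0|) ∧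
      |x 4 - y 4 - (x 0 - y 0) - ε * (∑ j ∈ Finset.range 4, (b' j - a' j)) * (x 0 - y 0)| ≤
        |ε| * (24 * η + 384 * K ^ 2 * |ε|) * |x 0 - y 0| := by
  set d : ℕ → ℝ := fun j => x j - y j with hd
  set κ := 2 * (|ε| * K) with hκ
  have hK : 0 ≤ K := hη0.trans hη
  have hκ0 : 0 ≤ κ := by positivity
  have hstep : ∀ j < 4, d (j + 1) - d j =
      ε * ((b j (x (j + 1)) - b j (y (j + 1))) - (a j (x j) - a j (y j))) := by
    intro j hj
    simp only [hd]
    linear_combination hx j hj - hy j hj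
  have hdiff : ∀ j < 4, |d (j + 1) - d j| ≤ κ * (|d (j + 1)| + |d j|) := by
    intro j hj
    rw [hstep j hj, abs_mul]
    have h1 := abs_sub_le_of_abs_sub_linear_le (hb' j hj) hη
      (hb j hj _ (hxI (j + 1) hj) _ (hyI (j + 1) hj))
    have h2 := abs_sub_le_of_abs_sub_linear_le (ha' j hj) hη
      (ha j hj _ (hxI j hj.le) _ (hyI j hj.le))
    have h3 := abs_sub (b j (x (j + 1)) - b j (y (j + 1))) (a j (x j) - a j (y j))
    have := mul_le_mul_of_nonneg_left (h3.trans (add_le_add h1 h2)) (abs_nonneg ε)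
    refine this.trans (le_of_eq ?_)
    simp only [hd, hκ]; ring
  have hκ1 : κ ≤ 1 / 8 := by rw [hκ]; linarith
  have hgrow : ∀ j < 4, |d (j + 1)| ≤ 9 / 7 * |d j| := by
    intro j hj
    have h1 := hdiff j hj
    have h2 := abs_sub_abs_le_abs_sub (d (j + 1)) (d j)
    have h3 : κ * (|d (j + 1)| + |d j|) ≤ 1 / 8 * (|d (j + 1)| + |d j|) := by gcongr
    linarith
  have h0 := hgrow 0 (by norm_num)
  have h1 := hgrow 1 (by norm_num)
  have h2 := hgrow 2 (by norm_num)
  have h3 := hgrow 3 (by norm_num)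
  have hpos := abs_nonneg (d 0)
  have hthree : ∀ j ≤ 4, |d j| ≤ 3 * |d 0| := by
    intro j hj
    norm_num at h0 h1 h2 h3
    interval_cases j <;> linarith
  have hdiff' : ∀ j < 4, |d (j + 1) - d j| ≤ 6 * κ * |d 0| := by
    intro j hj
    refine (hdiff j hj).trans ?_
    have := mul_le_mul_of_nonneg_left (add_le_add (hthree (j + 1) hj) (hthree j hj.le)) hκ0
    linarith
  have hfar : ∀ j ≤ 4, |d j - d 0| ≤ 24 * κ * |d 0| := by
    have hn : ∀ j : ℕ, j ≤ 4 → |d j - d 0| ≤ j * (6 * κ * |d 0|) := by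
      intro j
      induction j with
      | zero => simp
      | succ n ih =>
        intro hn
        have := abs_sub_le (d (n + 1)) (d n) (d 0)
        have := hdiff' n hn
        have := ih (by omega)
        push_cast
        linarith
    intro j hj
    refine (hn j hj).trans ?_
    have : (j : ℝ) ≤ 4 := by exact_mod_cast hj
    calc (j : ℝ) * (6 * κ * |d 0|) ≤ 4 * (6 * κ * |d 0|) := by gcongr
      _ = _ := by ring
  have hlin : ∀ (f : ℝ → ℝ) (c : ℝ) (j : ℕ), j ≤ 4 → |c| ≤ K →
      |f (x j) - f (y j) - c * (x j - y j)| ≤ η * |x j - y j| →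
      |f (x j) - f (y j) - c * d 0| ≤ (3 * η + 24 * κ * K) * |d 0| := by
    intro f c j hj hc h
    have h4 : |c * (d j - d 0)| ≤ K * (24 * κ * |d 0|) := by
      rw [abs_mul]
      exact mul_le_mul hc (hfar j hj) (abs_nonneg _) hK
    have h5 : η * |d j| ≤ η * (3 * |d 0|) := by gcongr; exact hthree j hj
    have h6 := abs_add_le (f (x j) - f (y j) - c * d j) (c * (d j - d 0))
    rw [show f (x j) - f (y j) - c * d j + c * (d j - d 0) = f (x j) - f (y j) - c * d 0 by
      ring] at h6
    change |f (x j) - f (y j) - c * d j| ≤ η * |d j| at h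
    linarith
  refine ⟨hthree, ?_⟩
  have hsum : d 4 - d 0 - ε * (∑ j ∈ Finset.range 4, (b' j - a' j)) * d 0 =
      ε * ∑ j ∈ Finset.range 4, ((b j (x (j + 1)) - b j (y (j + 1)) - b' j * d 0) -
        (a j (x j) - a j (y j) - a' j * d 0)) := by
    have s0 := hstep 0 (by norm_num)
    have s1 := hstep 1 (by norm_num)
    have s2 := hstep 2 (by norm_num)
    have s3 := hstep 3 (by norm_num)
    simp only [Finset.sum_range_succ, Finset.sum_range_zero]
    norm_num at s0 s1 s2 s3 ⊢
    linear_combination s0 + s1 + s2 + s3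
  change |d 4 - d 0 - ε * (∑ j ∈ Finset.range 4, (b' j - a' j)) * d 0| ≤ _ * |d 0|
  rw [hsum, abs_mul, mul_assoc |ε|]
  refine mul_le_mul_of_nonneg_left ?_ (abs_nonneg ε)
  refine (Finset.abs_sum_le_sum_abs _ _).trans ?_
  refine (Finset.sum_le_card_nsmul _ _ (2 * ((3 * η + 24 * κ * K) * |d 0|)) ?_).trans ?_
  · intro j hj
    rw [Finset.mem_range] at hj
    have e1 := hlin (b j) (b' j) (j + 1) hj (hb' j hj)
      (hb j hj _ (hxI (j + 1) hj) _ (hyI (j + 1) hj))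
    have e2 := hlin (a j) (a' j) j hj.le (ha' j hj)
      (ha j hj _ (hxI j hj.le) _ (hyI j hj.le))
    refine (abs_sub _ _).trans ?_
    linarith
  · simp only [Finset.card_range, nsmul_eq_mul, hκ]
    apply le_of_eq
    push_cast
    ring

/-- A crossing chain can be started at every point near the centre of the interval. -/
theorem exists_isCrossingChain {p δ N x₀ : ℝ}
    (hb : ∀ j < 4, ContinuousOn (b j) (Icc (p - δ) (p + δ))) (hN0 : 0 ≤ N)
    (hN : ∀ j < 4, ∀ u ∈ Icc (p - δ) (p + δ), ∀ v ∈ Icc (p - δ) (p + δ), |b j u - a j v| ≤ N)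
    (hx₀ : |x₀ - p| + 4 * (|ε| * N) ≤ δ) :
    ∃ x : ℕ → ℝ, x 0 = x₀ ∧ IsCrossingChain ε a b x ∧ ∀ j ≤ 4, |x j - x₀| ≤ 4 * (|ε| * N) := by
  set r := |ε| * N with hr
  have hr0 : 0 ≤ r := by positivity
  have hin : ∀ u, |u - x₀| ≤ 4 * r → u ∈ Icc (p - δ) (p + δ) := by
    intro u hu
    have := abs_sub_le u x₀ p
    have h := abs_le.1 (show |u - p| ≤ δ by linarith)
    exact ⟨by linarith [h.1], by linarith [h.2]⟩
  -- The next crossing solves a scalar equation, by the intermediate value theorem.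
  have step : ∀ j : ℕ, j < 4 → ∀ u : ℝ, |u - x₀| ≤ j * r →
      ∃ v, v - u = ε * (b j v - a j u) ∧ |v - x₀| ≤ (j + 1 : ℕ) * r := by
    intro j hj u hu
    have hj3 : (j : ℝ) + 1 ≤ 4 := by exact_mod_cast hj
    have hj4 : (j : ℝ) * r + r ≤ 4 * r := by nlinarith
    have hnear : ∀ v ∈ Icc (u - r) (u + r), |v - x₀| ≤ j * r + r := by
      intro v hv
      have h1 : |v - u| ≤ r := abs_le.2 ⟨by linarith [hv.1], by linarith [hv.2]⟩
      linarith [abs_sub_le v u x₀]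
    have hsub : Icc (u - r) (u + r) ⊆ Icc (p - δ) (p + δ) := fun v hv =>
      hin v ((hnear v hv).trans hj4)
    have huI : u ∈ Icc (p - δ) (p + δ) := hin u (by linarith)
    have hcont : ContinuousOn (fun v => v - ε * b j v) (Icc (u - r) (u + r)) :=
      continuousOn_id.sub (continuousOn_const.mul ((hb j hj).mono hsub))
    have hbd : ∀ v ∈ Icc (u - r) (u + r), |ε * (b j v - a j u)| ≤ r := by
      intro v hv
      rw [abs_mul]
      exact mul_le_mul_of_nonneg_left (hN j hj v (hsub hv) u huI) (abs_nonneg ε)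
    have hl : u - r ∈ Icc (u - r) (u + r) := ⟨le_rfl, by linarith⟩
    have hu' : u + r ∈ Icc (u - r) (u + r) := ⟨by linarith, le_rfl⟩
    obtain ⟨v, hv, hveq⟩ := intermediate_value_Icc (by linarith) hcont
      (show u - ε * a j u ∈ Icc _ _ from
        ⟨by have := (abs_le.1 (hbd _ hl)).1; linarith,
          by have := (abs_le.1 (hbd _ hu')).2; linarith⟩)
    refine ⟨v, by simp only at hveq; linarith, ?_⟩
    push_cast
    linarith [hnear v hv]
  have h : ∀ n : ℕ, n ≤ 4 → ∃ x : ℕ → ℝ, x 0 = x₀ ∧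
      (∀ j < n, x (j + 1) - x j = ε * (b j (x (j + 1)) - a j (x j))) ∧
      ∀ j ≤ n, |x j - x₀| ≤ j * r := by
    intro n
    induction n with
    | zero => exact fun _ => ⟨fun _ => x₀, rfl, by simp, by simp⟩
    | succ n ih =>
      intro hn
      obtain ⟨x, hx0, hx1, hx2⟩ := ih (by omega)
      obtain ⟨v, hv1, hv2⟩ := step n (by omega) (x n) (hx2 n le_rfl)
      refine ⟨Function.update x (n + 1) v, ?_, ?_, ?_⟩
      · rw [Function.update_of_ne (by omega), hx0]
      · intro j hj
        rw [Function.update_of_ne (a := j) (by omega)]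
        rcases Nat.lt_succ_iff_lt_or_eq.1 hj with h | rfl
        · rw [Function.update_of_ne (by omega)]
          exact hx1 j h
        · rw [Function.update_self]
          exact hv1
      · intro j hj
        rcases Nat.lt_or_ge j (n + 1) with h | h
        · rw [Function.update_of_ne (by omega)]
          exact hx2 j (by omega)
        · obtain rfl : j = n + 1 := by omega
          rw [Function.update_self]
          exact hv2
  obtain ⟨x, hx0, hx1, hx2⟩ := h 4 le_rfl
  refine ⟨x, hx0, hx1, fun j hj => (hx2 j hj).trans ?_⟩
  have : (j : ℝ) ≤ 4 := by exact_mod_cast hj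
  gcongr

end Chains

/-- A function that is close to linear with slope `m` has a zero near every point where it is
small. -/
theorem exists_zero_of_abs_sub_linear_le {f : ℝ → ℝ} {m p r : ℝ} (hm : m ≠ 0) (hr : 0 ≤ r)
    (hf : ∀ u ∈ Icc (p - r) (p + r), ∀ v ∈ Icc (p - r) (p + r),
      |f u - f v - m * (u - v)| ≤ |m| / 2 * |u - v|)
    (hp : |f p| ≤ |m| / 2 * r) : ∃ u ∈ Icc (p - r) (p + r), f u = 0 := by
  wlog hpos : 0 < m generalizing f m
  · obtain ⟨u, hu, h⟩ := this (f := fun u => - f u) (m := -m) (neg_ne_zero.2 hm)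
      (fun u hu v hv => by
        rw [abs_neg m, ← abs_neg]
        convert hf u hu v hv using 2
        ring)
      (by simpa using hp) (by
        rcases lt_or_gt_of_ne hm with h | h
        · linarith
        · exact absurd h hpos)
    exact ⟨u, hu, by simpa using h⟩
  rw [abs_of_pos hpos] at hf hp
  have hpI : p ∈ Icc (p - r) (p + r) := ⟨by linarith, by linarith⟩
  have hl : p - r ∈ Icc (p - r) (p + r) := ⟨le_rfl, by linarith⟩
  have hu : p + r ∈ Icc (p - r) (p + r) := ⟨by linarith, le_rfl⟩
  have hcont : ContinuousOn f (Icc (p - r) (p + r)) := by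
    refine (LipschitzOnWith.of_dist_le_mul (K := ⟨2 * m, by positivity⟩)
      fun u hu v hv => ?_).continuousOn
    have h := hf u hu v hv
    have h1 := abs_sub_abs_le_abs_sub (f u - f v) (m * (u - v))
    rw [abs_mul, abs_of_pos hpos] at h1
    rw [Real.dist_eq, Real.dist_eq]
    change _ ≤ 2 * m * |u - v|
    nlinarith [abs_nonneg (u - v)]
  have h1 := (abs_le.1 (hf _ hu _ hpI)).1
  have h2 := (abs_le.1 (hf _ hl _ hpI)).2
  rw [show p + r - p = r by ring, abs_of_nonneg hr] at h1
  rw [show p - r - p = -r by ring, abs_neg, abs_of_nonneg hr] at h2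
  have h3 := abs_le.1 hp
  exact intermediate_value_Icc (by linarith) hcont ⟨by linarith [h3.1], by linarith [h3.2]⟩

/-- A bounded two-sided sequence that follows a hyperbolic linear recursion up to a small relative
error vanishes. -/
theorem eq_zero_of_hyperbolic_recursion {e : ℤ → ℝ} {μ B : ℝ} (hμ : μ ≠ 0) (hμ1 : |μ| ≤ 1)
    (hB : ∀ k, |e k| ≤ B) (he : ∀ k, |e (k + 1) - e k - μ * e k| ≤ |μ| / 2 * |e k|) (k : ℤ) :
    e k = 0 := by
  by_contra hne
  have hpos : 0 < |e k| := abs_pos.2 hne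
  have hμ0 : 0 < |μ| := abs_pos.2 hμ
  rcases lt_or_gt_of_ne hμ with h | h
  · -- Contraction: run the recursion backwards.
    rw [abs_of_neg h] at he hμ1 hμ0
    have hstep : ∀ n : ℕ, (1 + -μ / 2) ^ n * |e k| ≤ |e (k - n)| := by
      intro n
      induction n with
      | zero => simp
      | succ n ih =>
        have h1 := he (k - (n + 1 : ℕ))
        rw [show k - ((n + 1 : ℕ) : ℤ) + 1 = k - n by push_cast; ring] at h1
        set E := e (k - (n + 1 : ℕ))
        have h2 := abs_sub_abs_le_abs_sub (e (k - n)) ((1 + μ) * E)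
        rw [abs_mul, abs_of_nonneg (by linarith : 0 ≤ 1 + μ),
          show e (k - n) - (1 + μ) * E = e (k - n) - E - μ * E by ring] at h2
        have h3 : |e (k - n)| ≤ (1 - -μ / 2) * |E| := by linarith
        rw [pow_succ']
        have h4 : (1 + -μ / 2) * |e (k - n)| ≤ (1 + -μ / 2) * ((1 - -μ / 2) * |E|) := by
          gcongr
        have h5 : (1 + -μ / 2) * ((1 - -μ / 2) * |E|) ≤ |E| := by
          nlinarith [abs_nonneg E, mul_nonneg (sq_nonneg μ) (abs_nonneg E)]
        have h6 : (1 + -μ / 2) * ((1 + -μ / 2) ^ n * |e k|) ≤ (1 + -μ / 2) * |e (k - n)| := by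
          gcongr
        linarith
    obtain ⟨n, hn⟩ := pow_unbounded_of_one_lt (B / |e k|) (by linarith : 1 < 1 + -μ / 2)
    rw [div_lt_iff₀ hpos] at hn
    linarith [hstep n, hB (k - n)]
  · -- Expansion: run the recursion forwards.
    rw [abs_of_pos h] at he hμ1 hμ0
    have hstep : ∀ n : ℕ, (1 + μ / 2) ^ n * |e k| ≤ |e (k + n)| := by
      intro n
      induction n with
      | zero => simp
      | succ n ih =>
        have h1 := he (k + n)
        rw [show k + (n : ℤ) + 1 = k + (n + 1 : ℕ) by push_cast; ring] at h1
        have h2 := abs_sub_abs_le_abs_sub ((1 + μ) * e (k + n)) (e (k + (n + 1 : ℕ)))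
        rw [abs_mul, abs_of_nonneg (by linarith : 0 ≤ 1 + μ), abs_sub_comm,
          show e (k + (n + 1 : ℕ)) - (1 + μ) * e (k + n) =
            e (k + (n + 1 : ℕ)) - e (k + n) - μ * e (k + n) by ring] at h2
        have h6 : (1 + μ / 2) * ((1 + μ / 2) ^ n * |e k|) ≤ (1 + μ / 2) * |e (k + n)| := by
          gcongr
        rw [pow_succ']
        linarith
    obtain ⟨n, hn⟩ := pow_unbounded_of_one_lt (B / |e k|) (by linarith : 1 < 1 + μ / 2)
    rw [div_lt_iff₀ hpos] at hn
    linarith [hstep n, hB (k + n)]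

/-- If the return displacement is `ε` times a function with slope close to `m ≠ 0`, and it is small
at `p`, then there is a closed crossing chain near `p`. -/
theorem exists_closed_isCrossingChain {ε m p δ N c : ℝ} {a b : ℕ → ℝ → ℝ} (hε : ε ≠ 0)
    (hm : m ≠ 0) (hb : ∀ j < 4, ContinuousOn (b j) (Icc (p - δ) (p + δ))) (hN0 : 0 ≤ N)
    (hN : ∀ j < 4, ∀ u ∈ Icc (p - δ) (p + δ), ∀ v ∈ Icc (p - δ) (p + δ), |b j u - a j v| ≤ N)
    (hsub : ∀ x y : ℕ → ℝ, IsCrossingChain ε a b x → IsCrossingChain ε a b y →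
      (∀ j ≤ 4, x j ∈ Icc (p - δ) (p + δ)) → (∀ j ≤ 4, y j ∈ Icc (p - δ) (p + δ)) →
      |x 4 - y 4 - (x 0 - y 0) - ε * m * (x 0 - y 0)| ≤ |ε| * (|m| / 2) * |x 0 - y 0|)
    (hp : ∀ x : ℕ → ℝ, IsCrossingChain ε a b x → x 0 = p →
      (∀ j ≤ 4, |x j - p| ≤ 4 * (|ε| * N)) → |x 4 - x 0| ≤ |ε| * (|m| / 2 * c))
    (hc0 : 0 ≤ c) (hc : c + 4 * (|ε| * N) ≤ δ) :
    ∃ q : ℕ → ℝ, IsCrossingChain ε a b q ∧ q 4 = q 0 ∧ ∀ j ≤ 4, |q j - p| ≤ c + 4 * (|ε| * N) := by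
  have hex : ∀ u ∈ Icc (p - c) (p + c), ∃ x : ℕ → ℝ, x 0 = u ∧ IsCrossingChain ε a b x ∧
      ∀ j ≤ 4, |x j - u| ≤ 4 * (|ε| * N) := by
    intro u hu
    have : |u - p| ≤ c := abs_le.2 ⟨by linarith [hu.1], by linarith [hu.2]⟩
    exact exists_isCrossingChain hb hN0 hN (by linarith)
  choose! X hX0 hX1 hX2 using hex
  have hfar : ∀ u ∈ Icc (p - c) (p + c), ∀ j ≤ 4, |X u j - p| ≤ c + 4 * (|ε| * N) := by
    intro u hu j hj
    have : |u - p| ≤ c := abs_le.2 ⟨by linarith [hu.1], by linarith [hu.2]⟩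
    linarith [hX2 u hu j hj, abs_sub_le (X u j) u p]
  have hmem : ∀ u ∈ Icc (p - c) (p + c), ∀ j ≤ 4, X u j ∈ Icc (p - δ) (p + δ) := by
    intro u hu j hj
    have := abs_le.1 ((hfar u hu j hj).trans hc)
    exact ⟨by linarith [this.1], by linarith [this.2]⟩
  have hε0 : 0 < |ε| := abs_pos.2 hε
  obtain ⟨u, hu, h⟩ := exists_zero_of_abs_sub_linear_le (f := fun u => (X u 4 - u) / ε) (p := p)
    (r := c) hm hc0 (fun u hu v hv => by
      have := hsub _ _ (hX1 u hu) (hX1 v hv) (hmem u hu) (hmem v hv)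
      rw [hX0 u hu, hX0 v hv] at this
      rw [show (X u 4 - u) / ε - (X v 4 - v) / ε - m * (u - v) =
        (X u 4 - X v 4 - (u - v) - ε * m * (u - v)) / ε by field_simp; ring, abs_div,
        div_le_iff₀ hε0]
      linarith) (by
      have hpI : p ∈ Icc (p - c) (p + c) := ⟨by linarith, by linarith⟩
      have := hp _ (hX1 p hpI) (hX0 p hpI) (hX2 p hpI)
      rw [hX0 p hpI] at this
      rw [abs_div, div_le_iff₀ hε0]
      linarith)
  refine ⟨X u, hX1 u hu, ?_, hfar u hu⟩
  rw [hX0 u hu]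
  have := (div_eq_zero_iff.1 h).resolve_right hε
  linarith

/-! ### Flow coordinates -/

/-- A flow coordinate `H` for the field `w' = i + ε g w` on `D`: along solutions `H` increases at
the rate `i`, so that `Im H` measures time and `Re H` is a first integral; moreover `H` is
`κ`-close to the identity. -/
structure IsFlowCoordinate (g H : ℂ → ℂ) (ε κ : ℝ) (D : Set ℂ) : Prop where
  field_ne : ∀ w ∈ D, Complex.I + ε * g w ≠ 0
  hasDerivAt : ∀ w ∈ D, HasDerivAt H (Complex.I / (Complex.I + ε * g w)) w
  near_id : ∀ u ∈ D, ∀ v ∈ D, ‖H u - H v - (u - v)‖ ≤ κ * ‖u - v‖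

/-- On a disk, a flow coordinate is `w + i ε (A w + B w)`, with `A` a primitive of `g` and with a
correction `B` that has a Lipschitz constant of order `ε`. -/
theorem exists_isFlowCoordinate {g A : ℂ → ℂ} {ε C R : ℝ} {c : ℂ}
    (hg : DifferentiableOn ℂ g (Metric.ball c R)) (hC : ∀ w ∈ Metric.ball c R, ‖g w‖ ≤ C)
    (hA : ∀ w ∈ Metric.ball c R, HasDerivAt A (g w) w) (hε : |ε| * C ≤ 1 / 2) :
    ∃ B : ℂ → ℂ, (∀ u ∈ Metric.ball c R, ∀ v ∈ Metric.ball c R,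
        ‖B u - B v‖ ≤ 2 * C ^ 2 * |ε| * ‖u - v‖) ∧
      IsFlowCoordinate g (fun w => w + Complex.I * ε * (A w + B w)) ε (2 * C * |ε|)
        (Metric.ball c R) := by
  have hεg : ∀ w ∈ Metric.ball c R, ‖(ε : ℂ) * g w‖ ≤ 1 / 2 := by
    intro w hw
    rw [norm_mul, Complex.norm_real, Real.norm_eq_abs]
    exact (mul_le_mul_of_nonneg_left (hC w hw) (abs_nonneg ε)).trans hε
  have hden : ∀ w ∈ Metric.ball c R, 1 / 2 ≤ ‖1 - Complex.I * ε * g w‖ := by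
    intro w hw
    have h1 := norm_sub_norm_le (1 : ℂ) (Complex.I * ε * g w)
    have h2 := hεg w hw
    rw [mul_assoc Complex.I, norm_mul, Complex.norm_I, one_mul, norm_one] at h1
    rw [mul_assoc]
    linarith
  have hden0 : ∀ w ∈ Metric.ball c R, 1 - Complex.I * ε * g w ≠ 0 := by
    intro w hw h
    have := hden w hw
    rw [h, norm_zero] at this
    linarith
  have hfac : ∀ w, Complex.I + ε * g w = Complex.I * (1 - Complex.I * ε * g w) := by
    intro w
    linear_combination ((ε : ℂ) * g w) * Complex.I_mul_I
  have hprim : DifferentiableOn ℂ (fun w => Complex.I * ε * g w ^ 2 / (1 - Complex.I * ε * g w))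
      (Metric.ball c R) :=
    ((hg.pow 2).const_mul _).div ((differentiableOn_const _).sub (hg.const_mul _)) hden0
  obtain ⟨B, hB⟩ := hprim.isExactOn_ball
  have hC0 : ∀ w ∈ Metric.ball c R, 0 ≤ C := fun w hw => (norm_nonneg _).trans (hC w hw)
  have hdiv : ∀ w ∈ Metric.ball c R, ∀ x : ℂ, ‖x / (1 - Complex.I * ε * g w)‖ ≤ 2 * ‖x‖ := by
    intro w hw x
    rw [norm_div, div_le_iff₀ (by linarith [hden w hw])]
    nlinarith [hden w hw, norm_nonneg x]
  refine ⟨B, fun u hu v hv => ?_, fun w hw => ?_, fun w hw => ?_, fun u hu v hv => ?_⟩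
  · refine (convex_ball c R).norm_image_sub_le_of_norm_hasDerivWithin_le
      (fun w hw => (hB w hw).hasDerivWithinAt) (fun w hw => ?_) hv hu
    refine (hdiv w hw _).trans ?_
    rw [norm_mul, norm_mul, norm_pow, Complex.norm_I, one_mul, Complex.norm_real, Real.norm_eq_abs]
    have := pow_le_pow_left₀ (norm_nonneg _) (hC w hw) 2
    nlinarith [abs_nonneg ε]
  · rw [hfac]
    exact mul_ne_zero Complex.I_ne_zero (hden0 w hw)
  · have h := (hasDerivAt_id w).add (((hA w hw).add (hB w hw)).const_mul (Complex.I * ε))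
    refine h.congr_deriv ?_
    rw [hfac]
    have := hden0 w hw
    field_simp
    ring
  · have hd : ∀ w ∈ Metric.ball c R, HasDerivWithinAt (fun w => Complex.I * ε * (A w + B w))
        (Complex.I * ε * g w / (1 - Complex.I * ε * g w)) (Metric.ball c R) w := by
      intro w hw
      refine ((((hA w hw).add (hB w hw)).const_mul (Complex.I * ε)).congr_deriv ?_).hasDerivWithinAt
      have := hden0 w hw
      field_simp
      ring
    have := (convex_ball c R).norm_image_sub_le_of_norm_hasDerivWithin_le (C := 2 * C * |ε|) hd
      (fun w hw => by
        refine (hdiv w hw _).trans ?_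
        rw [norm_mul, norm_mul, Complex.norm_I, one_mul, Complex.norm_real, Real.norm_eq_abs]
        nlinarith [abs_nonneg ε, hC w hw]) hv hu
    refine le_trans (le_of_eq ?_) this
    congr 1
    ring

namespace IsFlowCoordinate

variable {g H : ℂ → ℂ} {ε κ : ℝ} {D : Set ℂ}

theorem injOn (hH : IsFlowCoordinate g H ε κ D) (hκ : κ ≤ 1 / 4) : InjOn H D := by
  intro u hu v hv h
  have h1 := hH.near_id u hu v hv
  rw [h, sub_self, zero_sub, norm_neg] at h1
  have : ‖u - v‖ = 0 := by nlinarith [norm_nonneg (u - v)]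
  exact sub_eq_zero.1 (norm_eq_zero.1 this)

theorem lipschitzOnWith (hH : IsFlowCoordinate g H ε κ D) (hκ : κ ≤ 1 / 4) :
    LipschitzOnWith 2 H D := by
  refine LipschitzOnWith.of_dist_le_mul fun u hu v hv => ?_
  rw [dist_eq_norm, dist_eq_norm]
  have h1 := hH.near_id u hu v hv
  have h2 := norm_sub_norm_le (H u - H v) (u - v)
  push_cast
  nlinarith [norm_nonneg (u - v)]

/-- The inverse of a flow coordinate yields solutions of `w' = i + ε g w` that start at a given
point near the centre of the disk. The radii leave room for one arc between two cuts. -/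
theorem exists_arc {c p : ℂ} (hH : IsFlowCoordinate g H ε κ (Metric.ball c 40)) (hκ : κ ≤ 1 / 4)
    (hp : ‖p - c‖ ≤ 12) :
    ∃ W : ℝ → ℂ, W 0 = p ∧ ∀ s ∈ Ioo (-1 : ℝ) 20, W s ∈ Metric.ball c 40 ∧
      H (W s) = H p + Complex.I * s ∧ HasDerivAt W (Complex.I + ε * g (W s)) s := by
  have happ : ApproximatesLinearOn H ((ContinuousLinearEquiv.refl ℂ ℂ : ℂ ≃L[ℂ] ℂ) : ℂ →L[ℂ] ℂ)
      (Metric.ball c 40) (1 / 4) := by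
    intro u hu v hv
    refine (hH.near_id u hu v hv).trans ?_
    push_cast
    gcongr
  have hN : ‖((ContinuousLinearEquiv.refl ℂ ℂ).symm : ℂ →L[ℂ] ℂ)‖₊ = 1 := by
    have : ‖ContinuousLinearMap.id ℂ ℂ‖₊ = 1 := by
      rw [← NNReal.coe_inj]
      simp
    exact this
  have hc : Subsingleton ℂ ∨ (1 / 4 : ℝ≥0) <
      ‖((ContinuousLinearEquiv.refl ℂ ℂ).symm : ℂ →L[ℂ] ℂ)‖₊⁻¹ := by
    right
    rw [hN, inv_one, ← NNReal.coe_lt_coe]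
    norm_num
  set e := happ.toOpenPartialHomeomorph H _ hc Metric.isOpen_ball with he
  have hpD : p ∈ Metric.ball c 40 := by
    rw [mem_ball_iff_norm]
    linarith
  have htarget : ∀ s ∈ Ioo (-1 : ℝ) 20, H p + Complex.I * s ∈ e.target := by
    intro s hs
    have hs' : |s| ≤ 20 := abs_le.2 ⟨by linarith [hs.1], hs.2.le⟩
    have hI : ‖Complex.I * (s : ℂ)‖ = |s| := by
      rw [norm_mul, Complex.norm_I, one_mul, Complex.norm_real, Real.norm_eq_abs]
    have hball : Metric.closedBall (p + Complex.I * s) (|s| / 3) ⊆ Metric.ball c 40 := by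
      intro z hz
      rw [mem_closedBall_iff_norm] at hz
      rw [mem_ball_iff_norm]
      have h1 := norm_add_le (z - (p + Complex.I * s)) (p - c + Complex.I * s)
      have h2 := norm_add_le (p - c) (Complex.I * (s : ℂ))
      rw [hI] at h2
      rw [show z - (p + Complex.I * s) + (p - c + Complex.I * s) = z - c by ring] at h1
      linarith
    have h := happ.closedBall_subset_target hc Metric.isOpen_ball (by positivity) hball
    apply h
    rw [mem_closedBall_iff_norm, hN]
    have hmem : p + Complex.I * s ∈ Metric.ball c 40 :=
      hball (Metric.mem_closedBall_self (by positivity))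
    have h1 := hH.near_id p hpD _ hmem
    rw [show p - (p + Complex.I * s) = -(Complex.I * s) by ring, norm_neg, hI] at h1
    rw [show H p + Complex.I * s - H (p + Complex.I * s) =
      H p - H (p + Complex.I * s) - -(Complex.I * s) by ring]
    push_cast
    nlinarith [abs_nonneg s]
  refine ⟨fun s => e.symm (H p + Complex.I * s), ?_, fun s hs => ?_⟩
  · simp only [Complex.ofReal_zero, mul_zero, add_zero]
    exact e.left_inv (x := p) hpD
  · have hmem : e.symm (H p + Complex.I * s) ∈ Metric.ball c 40 := e.map_target (htarget s hs)
    refine ⟨hmem, e.right_inv (htarget s hs), ?_⟩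
    have hne := hH.field_ne _ hmem
    have h1 : HasDerivAt e.symm _ _ := e.hasDerivAt_symm (htarget s hs)
      (div_ne_zero Complex.I_ne_zero hne) (hH.hasDerivAt _ hmem)
    have h2 : HasDerivAt (fun s : ℝ => H p + Complex.I * (s : ℂ)) Complex.I s := by
      simpa using ((Complex.ofRealCLM.hasDerivAt (x := s)).const_mul Complex.I).const_add (H p)
    refine (h1.comp s h2).congr_deriv ?_
    rw [inv_div, div_mul_cancel₀ _ Complex.I_ne_zero]

end IsFlowCoordinate

/-! ### Lifted solutions between the cuts -/

/-- The data for a local study of the perturbed system in the strip `|Re w - p| ≤ δ` of the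
logarithmic plane: a flow coordinate `H σ` for the field of each zone, on a disk that contains more
than one turn of the strip, and a bound `κ` on the size of the perturbation that is small compared
with the slopes `L` of the cuts and the width of the strip. The angles of all the cuts lie in
`[0, 8]`, and an arc takes a time less than `20`; the absolute constants `40` and `54` are chosen
generously on this basis. -/
structure IsFrame (h : Zone → Polynomial ℂ) (H : Zone → ℂ → ℂ) (ε p δ L κ : ℝ) : Prop where
  δ_lt : δ < p
  δ_le : δ ≤ 1
  abs_deriv_cut_le : ∀ j ≤ 4, ∀ x ∈ Icc (p - δ) (p + δ), |deriv (cut j) x| ≤ L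
  flow : ∀ σ, IsFlowCoordinate (logField (h σ)) (H σ) ε κ (Metric.ball (p : ℂ) 40)
  field_le : ∀ σ w, w.re ∈ Icc (p - δ) (p + δ) → |ε| * ‖logField (h σ) w‖ ≤ κ
  κ_mul_le : κ * (1 + L) ≤ 1 / 2
  κ_le_δ : 54 * κ ≤ δ

/-- The image of a Filippov solution in the logarithmic plane. -/
def IsLiftedSolution (h : Zone → Polynomial ℂ) (ε : ℝ) (w : ℝ → ℂ) : Prop :=
  (∃ K : ℝ≥0, LipschitzWith K w) ∧ ∀ᵐ t : ℝ, ∃ v : ℂ,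
    Complex.exp (w t) * v ∈ filippov (perturbedCenter h ε) (Complex.exp (w t)) ∧ HasDerivAt w v t

/-- The angle by which a point of the logarithmic plane lies past the `j`-th cut. -/
noncomputable def phase (j : ℕ) (w : ℂ) : ℝ := w.im - cut j w.re

/-- The point on the `j`-th cut with logarithmic radius `x`. -/
noncomputable def cutPoint (j : ℕ) (x : ℝ) : ℂ := ⟨x, cut j x⟩

theorem eq_cutPoint_of_phase_eq_zero {j : ℕ} {w : ℂ} (h : phase j w = 0) :
    w = cutPoint j w.re :=
  Complex.ext rfl (sub_eq_zero.1 h)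

@[simp]
theorem phase_cutPoint (j : ℕ) (x : ℝ) : phase j (cutPoint j x) = 0 := sub_self _

theorem IsLiftedSolution.sub_const {h : Zone → Polynomial ℂ} {ε : ℝ} {w : ℝ → ℂ}
    (hw : IsLiftedSolution h ε w) {c : ℂ} (hc : Complex.exp c = 1) :
    IsLiftedSolution h ε fun t => w t - c := by
  obtain ⟨⟨K, hK⟩, hae⟩ := hw
  refine ⟨⟨K, LipschitzWith.of_dist_le_mul fun s t => ?_⟩, ?_⟩
  · rw [dist_sub_right]
    exact hK.dist_le_mul s t
  · filter_upwards [hae] with t ⟨v, hv, hd⟩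
    refine ⟨v, ?_, hd.sub_const c⟩
    rwa [Complex.exp_sub, hc, div_one]

namespace IsFrame

variable {h : Zone → Polynomial ℂ} {H : Zone → ℂ → ℂ} {ε p δ L κ : ℝ}

theorem pos_of_mem (hF : IsFrame h H ε p δ L κ) {x : ℝ} (hx : x ∈ Icc (p - δ) (p + δ)) :
    0 < x := by
  linarith [hx.1, hF.δ_lt]

theorem κ_le (hF : IsFrame h H ε p δ L κ) : κ ≤ 1 / 4 := by
  linarith [hF.κ_le_δ, hF.δ_le]

theorem hasDerivAt_cut (hF : IsFrame h H ε p δ L κ) {j : ℕ} (hj : j ≤ 4) {x : ℝ}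
    (hx : x ∈ Icc (p - δ) (p + δ)) : HasDerivAt (cut j) (deriv (cut j) x) x :=
  ((contDiffAt_cut hj (hF.pos_of_mem hx)).differentiableAt (by norm_num)).hasDerivAt

/-- Every curve whose velocity is close to `i` crosses the cuts transversally: its phase grows at
least at rate `1 / 2`. -/
theorem phase_growth (hF : IsFrame h H ε p δ L κ) {j : ℕ} (hj : j ≤ 4) {w : ℝ → ℂ} {K : ℝ≥0}
    {s t : ℝ} (hst : s ≤ t) (hw : LipschitzOnWith K w (Icc s t))
    (hstrip : ∀ r ∈ Icc s t, (w r).re ∈ Icc (p - δ) (p + δ))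
    (hd : ∀ᵐ r : ℝ, r ∈ Ioo s t → ∃ v : ℂ, ‖v - Complex.I‖ ≤ κ ∧ HasDerivAt w v r) :
    1 / 2 * (t - s) ≤ phase j (w t) - phase j (w s) := by
  have hre : LipschitzOnWith K (fun r => (w r).re) (Icc s t) := by
    refine LipschitzOnWith.of_dist_le_mul fun x hx y hy => ?_
    refine le_trans ?_ (hw.dist_le_mul x hx y hy)
    rw [Real.dist_eq, dist_eq_norm, ← Complex.sub_re]
    exact Complex.abs_re_le_norm _
  have him : LipschitzOnWith K (fun r => (w r).im) (Icc s t) := by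
    refine LipschitzOnWith.of_dist_le_mul fun x hx y hy => ?_
    refine le_trans ?_ (hw.dist_le_mul x hx y hy)
    rw [Real.dist_eq, dist_eq_norm, ← Complex.sub_im]
    exact Complex.abs_im_le_norm _
  have hL0 : 0 ≤ L := (abs_nonneg _).trans
    (hF.abs_deriv_cut_le j hj _ (hstrip s (left_mem_Icc.2 hst)))
  have hcut : LipschitzOnWith (⟨L, hL0⟩ : ℝ≥0) (cut j) (Icc (p - δ) (p + δ)) :=
    (convex_Icc _ _).lipschitzOnWith_of_nnnorm_hasDerivWithin_le
      (fun x hx => (hF.hasDerivAt_cut hj hx).hasDerivWithinAt)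
      (fun x hx => hF.abs_deriv_cut_le j hj x hx)
  have hphase := him.sub (hcut.comp hre hstrip)
  refine mul_sub_le_of_ae_le_deriv hst hphase ?_
  filter_upwards [hd] with r hr hmem
  obtain ⟨v, hv, hdv⟩ := hr hmem
  have hJ := hstrip r (Ioo_subset_Icc_self hmem)
  have h1 : HasDerivAt (fun r => (w r).re) v.re r := Complex.reCLM.hasFDerivAt.comp_hasDerivAt r hdv
  have h2 : HasDerivAt (fun r => (w r).im) v.im r := Complex.imCLM.hasFDerivAt.comp_hasDerivAt r hdv
  refine ⟨_, ?_, h2.sub ((hF.hasDerivAt_cut hj hJ).comp r h1)⟩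
  have e1 := (Complex.abs_re_le_norm (v - Complex.I)).trans hv
  have e2 := (Complex.abs_im_le_norm (v - Complex.I)).trans hv
  simp only [Complex.sub_re, Complex.I_re, sub_zero, Complex.sub_im, Complex.I_im] at e1 e2
  have e3 : |deriv (cut j) (w r).re * v.re| ≤ L * κ := by
    rw [abs_mul]
    exact mul_le_mul (hF.abs_deriv_cut_le j hj _ hJ) e1 (abs_nonneg _) hL0
  have := hF.κ_mul_le
  have := (abs_le.1 e2).1
  have := (abs_le.1 e3).2
  linarith

theorem velocity_near (hF : IsFrame h H ε p δ L κ) {w v : ℂ} (hw : w.re ∈ Icc (p - δ) (p + δ))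
    (hv : Complex.exp w * v ∈ filippov (perturbedCenter h ε) (Complex.exp w)) :
    ‖v - Complex.I‖ ≤ κ :=
  norm_sub_I_le_of_mem_filippov (fun σ => hF.field_le σ w hw) hv

/-- Strictly between two consecutive cuts, the Filippov velocity in the logarithmic plane is the
single logarithmic field of the zone. -/
theorem velocity_eq (hF : IsFrame h H ε p δ L κ) {j : ℕ} (hj : j < 4) {w v : ℂ}
    (hw : w.re ∈ Icc (p - δ) (p + δ)) (h1 : 0 < phase j w) (h2 : phase (j + 1) w < 0)
    (hv : Complex.exp w * v ∈ filippov (perturbedCenter h ε) (Complex.exp w)) :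
    v = Complex.I + ε * logField (h (zoneAt j)) w := by
  rw [filippov_exp hj (hF.pos_of_mem hw) (sub_pos.1 h1) (sub_neg.1 h2), mem_singleton_iff,
    perturbedCenter_exp] at hv
  exact mul_left_cancel₀ (Complex.exp_ne_zero _) hv

/-- A point of the strip between the first and the last cut lies well inside the disk. -/
theorem norm_sub_le (hF : IsFrame h H ε p δ L κ) {w : ℂ} (hw : w.re ∈ Icc (p - δ) (p + δ))
    {i j : ℕ} (hi : i ≤ 4) (hj : j ≤ 4) (h1 : 0 ≤ phase i w) (h2 : phase j w ≤ 0) :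
    ‖w - p‖ ≤ 12 := by
  have hp := hF.pos_of_mem hw
  have := cut_pos hi hp
  have := cut_le hj hp
  have := Real.pi_lt_d2
  have him : |(w - p).im| ≤ 8 := by
    simp only [phase] at h1 h2
    simp only [Complex.sub_im, Complex.ofReal_im, sub_zero]
    exact abs_le.2 ⟨by linarith, by linarith⟩
  have hre : |(w - p).re| ≤ 1 := by
    simp only [Complex.sub_re, Complex.ofReal_re]
    exact abs_le.2 ⟨by linarith [hw.1, hF.δ_le], by linarith [hw.2, hF.δ_le]⟩
  linarith [Complex.norm_le_abs_re_add_abs_im (w - p)]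

theorem mem_ball (hF : IsFrame h H ε p δ L κ) {w : ℂ} (hw : w.re ∈ Icc (p - δ) (p + δ))
    {i j : ℕ} (hi : i ≤ 4) (hj : j ≤ 4) (h1 : 0 ≤ phase i w) (h2 : phase j w ≤ 0) :
    w ∈ Metric.ball (p : ℂ) 40 := by
  rw [mem_ball_iff_norm]
  linarith [hF.norm_sub_le hw hi hj h1 h2]

theorem norm_cutPoint_sub_le (hF : IsFrame h H ε p δ L κ) {j : ℕ} (hj : j ≤ 4) {x : ℝ}
    (hx : x ∈ Icc (p - δ) (p + δ)) : ‖cutPoint j x - p‖ ≤ 12 :=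
  hF.norm_sub_le (w := cutPoint j x) hx hj hj (phase_cutPoint j x).ge (phase_cutPoint j x).le

theorem cutPoint_mem_ball (hF : IsFrame h H ε p δ L κ) {j : ℕ} (hj : j ≤ 4) {x : ℝ}
    (hx : x ∈ Icc (p - δ) (p + δ)) : cutPoint j x ∈ Metric.ball (p : ℂ) 40 := by
  rw [mem_ball_iff_norm]
  linarith [hF.norm_cutPoint_sub_le hj hx]

section Lifted

variable {w : ℝ → ℂ}

theorem lifted_phase_growth (hF : IsFrame h H ε p δ L κ) (hw : IsLiftedSolution h ε w)
    (hstrip : ∀ t, (w t).re ∈ Icc (p - δ) (p + δ)) {j : ℕ} (hj : j ≤ 4) {s t : ℝ} (hst : s ≤ t) :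
    1 / 2 * (t - s) ≤ phase j (w t) - phase j (w s) := by
  obtain ⟨⟨K, hK⟩, hae⟩ := hw
  refine hF.phase_growth hj hst hK.lipschitzOnWith (fun r _ => hstrip r) ?_
  filter_upwards [hae] with r ⟨v, hv, hd⟩ _
  exact ⟨v, hF.velocity_near (hstrip r) hv, hd⟩

theorem lifted_phase_strictMono (hF : IsFrame h H ε p δ L κ) (hw : IsLiftedSolution h ε w)
    (hstrip : ∀ t, (w t).re ∈ Icc (p - δ) (p + δ)) {j : ℕ} (hj : j ≤ 4) :
    StrictMono fun t => phase j (w t) := by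
  intro s t hst
  have := hF.lifted_phase_growth hw hstrip hj hst.le
  simp only
  linarith

theorem exists_phase_eq (hF : IsFrame h H ε p δ L κ) (hw : IsLiftedSolution h ε w)
    (hstrip : ∀ t, (w t).re ∈ Icc (p - δ) (p + δ)) {j : ℕ} (hj : j ≤ 4) (y : ℝ) :
    ∃ t, phase j (w t) = y := by
  have hcut : ContinuousOn (cut j) (Icc (p - δ) (p + δ)) := fun x hx =>
    (hF.hasDerivAt_cut hj hx).continuousAt.continuousWithinAt
  obtain ⟨K, hK⟩ := hw.1
  have hcont : Continuous fun t => phase j (w t) :=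
    (Complex.continuous_im.comp hK.continuous).sub
      (hcut.comp_continuous (Complex.continuous_re.comp hK.continuous) hstrip)
  set r := 2 * |y - phase j (w 0)| with hr
  have hr0 : 0 ≤ r := by positivity
  have h1 := hF.lifted_phase_growth hw hstrip hj (s := 0) (t := r) hr0
  have h2 := hF.lifted_phase_growth hw hstrip hj (s := -r) (t := 0) (by linarith)
  have h3 := le_abs_self (y - phase j (w 0))
  have h4 := neg_abs_le (y - phase j (w 0))
  obtain ⟨t, _, ht⟩ := intermediate_value_Icc (show -r ≤ r by linarith) hcont.continuousOn
    (show y ∈ Icc _ _ from ⟨by linarith, by linarith⟩)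
  exact ⟨t, ht⟩

/-- The flow coordinate of the zone between two consecutive cuts measures the time along a lifted
solution on its way from one cut to the next. -/
theorem flowCoordinate_along (hF : IsFrame h H ε p δ L κ) (hw : IsLiftedSolution h ε w)
    (hstrip : ∀ t, (w t).re ∈ Icc (p - δ) (p + δ)) {j : ℕ} (hj : j < 4) {s₀ s₁ t : ℝ}
    (h0 : phase j (w s₀) = 0) (h1 : phase (j + 1) (w s₁) = 0) (ht : t ∈ Icc s₀ s₁) :
    H (zoneAt j) (w t) = H (zoneAt j) (w s₀) + Complex.I * ((t - s₀ : ℝ) : ℂ) := by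
  have hm0 := hF.lifted_phase_strictMono hw hstrip hj.le
  have hm1 := hF.lifted_phase_strictMono hw hstrip (j := j + 1) hj
  have hin : ∀ r ∈ Icc s₀ s₁, w r ∈ Metric.ball (p : ℂ) 40 := fun r hr =>
    hF.mem_ball (hstrip r) hj.le (j := j + 1) hj (h0 ▸ hm0.monotone hr.1) (h1 ▸ hm1.monotone hr.2)
  obtain ⟨⟨K, hK⟩, hae⟩ := hw
  refine eq_add_mul_of_ae_hasDerivAt_const (f := fun t => H (zoneAt j) (w t))
    (((hF.flow (zoneAt j)).lipschitzOnWith hF.κ_le).comp hK.lipschitzOnWith hin) ?_ ht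
  filter_upwards [hae] with r ⟨v, hv, hd⟩ hr
  have hp0 : 0 < phase j (w r) := h0 ▸ hm0 hr.1
  have hp1 : phase (j + 1) (w r) < 0 := h1 ▸ hm1 hr.2
  have hvel := hF.velocity_eq hj (hstrip r) hp0 hp1 hv
  have hball := hin r (Ioo_subset_Icc_self hr)
  refine (((hF.flow _).hasDerivAt _ hball).comp r hd).congr_deriv ?_
  rw [hvel, div_mul_cancel₀ _ ((hF.flow _).field_ne _ hball)]

/-- The crossing times of one turn of a lifted solution. -/
theorem exists_crossings (hF : IsFrame h H ε p δ L κ) (hw : IsLiftedSolution h ε w)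
    (hstrip : ∀ t, (w t).re ∈ Icc (p - δ) (p + δ)) :
    ∃ t : ℕ → ℝ, (∀ j ≤ 4, phase j (w (t j)) = 0) ∧ ∀ j < 4, t j < t (j + 1) := by
  have hex : ∀ j : ℕ, ∃ t, j ≤ 4 → phase j (w t) = 0 := by
    intro j
    rcases Nat.lt_or_ge 4 j with hj | hj
    · exact ⟨0, fun h => absurd h (by omega)⟩
    · obtain ⟨t, ht⟩ := hF.exists_phase_eq hw hstrip hj 0
      exact ⟨t, fun _ => ht⟩
  choose t ht using hex
  refine ⟨t, ht, fun j hj => ?_⟩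
  refine (hF.lifted_phase_strictMono hw hstrip (j := j + 1) hj).lt_iff_lt.1 ?_
  have hp := hF.pos_of_mem (hstrip (t j))
  have := cut_lt_cut hj hp hp
  have e := ht j hj.le
  simp only [ht (j + 1) hj]
  simp only [phase] at e ⊢
  linarith

end Lifted

end IsFrame

/-! ### Solutions in a thin annulus run through the orbit set -/

/-- The crossing equations in terms of the first integrals `Re H`: the points with logarithmic
radii `x j` on the consecutive cuts can be joined by orbit arcs. -/
def IsOrbitChain (H : Zone → ℂ → ℂ) (x : ℕ → ℝ) : Prop :=
  ∀ j < 4, (H (zoneAt j) (cutPoint (j + 1) (x (j + 1)))).re = (H (zoneAt j) (cutPoint j (x j))).re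

/-- The time that the orbit through the crossings `q` spends between the `j`-th and the
`(j+1)`-st cut. -/
noncomputable def arcTime (H : Zone → ℂ → ℂ) (q : ℕ → ℝ) (j : ℕ) : ℝ :=
  (H (zoneAt j) (cutPoint (j + 1) (q (j + 1)))).im - (H (zoneAt j) (cutPoint j (q j))).im

/-- The set of all points in the plane that lie on one of the four orbit arcs with crossings `q`. -/
def orbitSet (H : Zone → ℂ → ℂ) (p : ℝ) (q : ℕ → ℝ) : Set ℂ :=
  {z | ∃ j < 4, ∃ w ∈ Metric.ball (p : ℂ) 40, ∃ s ∈ Icc 0 (arcTime H q j),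
    H (zoneAt j) w = H (zoneAt j) (cutPoint j (q j)) + Complex.I * (s : ℂ) ∧ Complex.exp w = z}

theorem IsOrbitChain.flowCoordinate_eq {H : Zone → ℂ → ℂ} {q : ℕ → ℝ} (hq : IsOrbitChain H q)
    {j : ℕ} (hj : j < 4) : H (zoneAt j) (cutPoint (j + 1) (q (j + 1))) =
      H (zoneAt j) (cutPoint j (q j)) + Complex.I * (arcTime H q j : ℂ) := by
  apply Complex.ext
  · simp [hq j hj]
  · simp [arcTime]

theorem phase_sub_two_pi_mul (j : ℕ) (w : ℂ) (m : ℤ) :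
    phase j (w - m * (2 * Real.pi * Complex.I)) = phase j w - m * (2 * Real.pi) := by
  simp [phase]
  ring

theorem phase_four (w : ℂ) : phase 4 w = phase 0 w - 2 * Real.pi := by
  simp only [phase, cut_four]; ring

namespace IsFrame

variable {h : Zone → Polynomial ℂ} {H : Zone → ℂ → ℂ} {ε p δ L κ : ℝ}

/-- If the only two-sided sequence of consecutive orbit chains in the strip is the constant
sequence `q`, then every lifted solution in the strip runs exactly through the orbit set of `q`. -/
theorem range_eq_orbitSet (hF : IsFrame h H ε p δ L κ) {q : ℕ → ℝ}
    (hq : ∀ x : ℤ → ℕ → ℝ, (∀ m, IsOrbitChain H (x m)) →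
      (∀ m, ∀ j ≤ 4, x m j ∈ Icc (p - δ) (p + δ)) → (∀ m, x m 4 = x (m + 1) 0) →
      ∀ m, ∀ j ≤ 4, x m j = q j)
    {w : ℝ → ℂ} (hw : IsLiftedSolution h ε w) (hstrip : ∀ t, (w t).re ∈ Icc (p - δ) (p + δ)) :
    range (fun t => Complex.exp (w t)) = orbitSet H p q := by
  -- The lift turned back by `m` full turns, so that its `m`-th turn lies between the cuts.
  set W : ℤ → ℝ → ℂ := fun m t => w t - m * (2 * Real.pi * Complex.I) with hW
  have hWl : ∀ m, IsLiftedSolution h ε (W m) := fun m =>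
    hw.sub_const (Complex.exp_int_mul_two_pi_mul_I m)
  have hWre : ∀ m t, (W m t).re = (w t).re := by
    intro m t
    simp [hW]
  have hWs : ∀ m t, (W m t).re ∈ Icc (p - δ) (p + δ) := by
    intro m t
    rw [hWre]
    exact hstrip t
  have hWexp : ∀ m t, Complex.exp (W m t) = Complex.exp (w t) := by
    intro m t
    simp only [hW]
    rw [Complex.exp_sub, Complex.exp_int_mul_two_pi_mul_I, div_one]
  choose T hT hTlt using fun m => hF.exists_crossings (hWl m) (hWs m)
  have hcross : ∀ m, ∀ j ≤ 4, W m (T m j) = cutPoint j (w (T m j)).re := by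
    intro m j hj
    rw [← hWre m]
    exact eq_cutPoint_of_phase_eq_zero (hT m j hj)
  have hT4 : ∀ m, T m 4 = T (m + 1) 0 := by
    intro m
    refine (hF.lifted_phase_strictMono hw hstrip (j := 0) (by norm_num)).injective ?_
    have e1 := hT m 4 le_rfl
    have e2 := hT (m + 1) 0 (by norm_num)
    simp only [hW, phase_sub_two_pi_mul, phase_four] at e1 e2 ⊢
    push_cast at e2
    linarith
  have hchain : ∀ m, IsOrbitChain H fun j => (w (T m j)).re := by
    intro m j hj
    have := hF.flowCoordinate_along (hWl m) (hWs m) hj (hT m j hj.le) (hT m (j + 1) hj)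
      (right_mem_Icc.2 (hTlt m j hj).le)
    rw [hcross m j hj.le, hcross m (j + 1) hj] at this
    rw [this]
    simp
  have hval := hq (fun m j => (w (T m j)).re) hchain (fun m j _ => hstrip _)
    (fun m => by simp only [hT4])
  have hpoint : ∀ m, ∀ j ≤ 4, W m (T m j) = cutPoint j (q j) := by
    intro m j hj
    rw [hcross m j hj]
    exact congrArg _ (hval m j hj)
  have hlen : ∀ m, ∀ j < 4, arcTime H q j = T m (j + 1) - T m j := by
    intro m j hj
    have := hF.flowCoordinate_along (hWl m) (hWs m) hj (hT m j hj.le) (hT m (j + 1) hj)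
      (right_mem_Icc.2 (hTlt m j hj).le)
    rw [hpoint m j hj.le, hpoint m (j + 1) hj] at this
    rw [arcTime, this]
    simp
  have harc : ∀ m, ∀ j < 4, ∀ t ∈ Icc (T m j) (T m (j + 1)),
      H (zoneAt j) (W m t) = H (zoneAt j) (cutPoint j (q j)) + Complex.I * ((t - T m j : ℝ) : ℂ) ∧
        W m t ∈ Metric.ball (p : ℂ) 40 := by
    intro m j hj t ht
    have := hF.flowCoordinate_along (hWl m) (hWs m) hj (hT m j hj.le) (hT m (j + 1) hj) ht
    rw [hpoint m j hj.le] at this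
    refine ⟨this, hF.mem_ball (hWs m t) hj.le (j := j + 1) hj ?_ ?_⟩
    · rw [← hT m j hj.le]
      exact (hF.lifted_phase_strictMono (hWl m) (hWs m) hj.le).monotone ht.1
    · rw [← hT m (j + 1) hj]
      exact (hF.lifted_phase_strictMono (hWl m) (hWs m) (j := j + 1) hj).monotone ht.2
  ext z
  constructor
  · rintro ⟨t, rfl⟩
    have hpi := Real.pi_pos
    set m : ℤ := ⌊phase 0 (w t) / (2 * Real.pi)⌋ with hm
    have h1 : (m : ℝ) * (2 * Real.pi) ≤ phase 0 (w t) := by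
      rw [← le_div_iff₀ (by positivity)]
      exact Int.floor_le _
    have h2 : phase 0 (w t) < (m + 1) * (2 * Real.pi) := by
      rw [← div_lt_iff₀ (by positivity)]
      exact Int.lt_floor_add_one _
    have h3 : T m 0 ≤ t := by
      refine (hF.lifted_phase_strictMono (hWl m) (hWs m) (j := 0) (by norm_num)).le_iff_le.1 ?_
      simp only [hT m 0 (by norm_num)]
      simp only [hW, phase_sub_two_pi_mul]
      linarith
    have h4 : t ≤ T m 4 := by
      refine (hF.lifted_phase_strictMono (hWl m) (hWs m) (j := 4) (by norm_num)).le_iff_le.1 ?_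
      simp only [hT m 4 le_rfl]
      simp only [hW, phase_sub_two_pi_mul, phase_four]
      linarith
    obtain ⟨j, hj, ht⟩ : ∃ j < 4, t ∈ Icc (T m j) (T m (j + 1)) := by
      by_contra! hcon
      have hle : ∀ j : ℕ, j ≤ 4 → T m j ≤ t := by
        intro j
        induction j with
        | zero => exact fun _ => h3
        | succ n ih =>
          intro hn
          by_contra! hlt
          exact hcon n hn ⟨ih (by omega), hlt.le⟩
      have h5 : t = T m 4 := le_antisymm h4 (hle 4 le_rfl)
      exact hcon 3 (by norm_num) ⟨hle 3 (by norm_num), h5.le⟩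
    obtain ⟨e1, e2⟩ := harc m j hj t ht
    refine ⟨j, hj, W m t, e2, t - T m j, ⟨by linarith [ht.1], ?_⟩, e1, hWexp m t⟩
    rw [hlen m j hj]
    linarith [ht.2]
  · rintro ⟨j, hj, u, hu, s, hs, hHu, rfl⟩
    rw [hlen 0 j hj] at hs
    have ht : T 0 j + s ∈ Icc (T 0 j) (T 0 (j + 1)) := ⟨by linarith [hs.1], by linarith [hs.2]⟩
    obtain ⟨e1, e2⟩ := harc 0 j hj _ ht
    rw [add_sub_cancel_left, ← hHu] at e1
    refine ⟨T 0 j + s, ?_⟩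
    simp only
    rw [← hWexp 0, (hF.flow _).injOn hF.κ_le e2 hu e1]

/-- A Filippov solution in the annulus that corresponds to the strip lifts to the logarithmic
plane. -/
theorem exists_lift (hF : IsFrame h H ε p δ L κ) {γ : ℝ → ℂ}
    (hγ : IsSolution (filippov (perturbedCenter h ε)) γ)
    (hann : ∀ t, ‖γ t‖ ∈ Icc (Real.exp (p - δ)) (Real.exp (p + δ))) :
    ∃ w : ℝ → ℂ, IsLiftedSolution h ε w ∧ (∀ t, (w t).re ∈ Icc (p - δ) (p + δ)) ∧
      ∀ t, Complex.exp (w t) = γ t := by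
  have hpos : ∀ t, 0 < ‖γ t‖ := fun t => (Real.exp_pos _).trans_le (hann t).1
  have h0 : ∀ t, γ t ≠ 0 := fun t => norm_pos_iff.1 (hpos t)
  have hre : ∀ z t, Complex.exp z = γ t → z.re ∈ Icc (p - δ) (p + δ) := by
    intro z t hz
    have := hann t
    rw [← hz, Complex.norm_exp] at this
    exact ⟨Real.exp_le_exp.1 this.1, Real.exp_le_exp.1 this.2⟩
  have hvel : ∀ t v, v ∈ filippov (perturbedCenter h ε) (γ t) → ‖v / γ t‖ ≤ 2 := by
    intro t v hv
    have hlog := Complex.exp_log (h0 t)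
    have := hF.velocity_near (w := Complex.log (γ t)) (v := v / γ t) (hre _ _ hlog)
      (by rwa [hlog, mul_div_cancel₀ _ (h0 t)])
    have h2 := norm_sub_norm_le (v / γ t) Complex.I
    rw [Complex.norm_I] at h2
    linarith [hF.κ_le]
  obtain ⟨hac, hae⟩ := hγ
  have hlip : LipschitzWith (⟨2 * Real.exp (p + δ), by positivity⟩ : ℝ≥0) γ := by
    refine lipschitzWith_of_absolutelyContinuous hac ?_
    filter_upwards [hae] with t ⟨v, hv, hd⟩
    refine ⟨v, ?_, hd⟩
    have := hvel t v hv
    rw [norm_div, div_le_iff₀ (hpos t)] at this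
    refine this.trans ?_
    change _ ≤ 2 * Real.exp (p + δ)
    linarith [(hann t).2]
  obtain ⟨w, hwl, hexp, hwae⟩ := exists_log_lift (C := 2) hlip h0 (by
    filter_upwards [hae] with t ⟨v, hv, hd⟩
    exact ⟨v / γ t, by simpa using hvel t v hv, by rwa [mul_div_cancel₀ _ (h0 t)]⟩)
  refine ⟨w, ⟨⟨2, hwl⟩, ?_⟩, fun t => hre _ _ (hexp t), hexp⟩
  filter_upwards [hae, hwae] with t ⟨v, hv, hd⟩ ⟨u, hu, hwd⟩
  refine ⟨u, ?_, hwd⟩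
  rw [hexp, ← hd.unique hu]
  exact hv

end IsFrame

/-! ### Construction of a periodic solution -/

/-- A lifted solution over a bounded time interval, inside the strip `|Re w - p| ≤ δ`. -/
structure IsLiftedArc (h : Zone → Polynomial ℂ) (ε p δ : ℝ) (w : ℝ → ℂ) (a b : ℝ) : Prop where
  lipschitz : LipschitzOnWith 2 w (Icc a b)
  strip : ∀ t ∈ Icc a b, (w t).re ∈ Icc (p - δ) (p + δ)
  ae : ∀ᵐ t : ℝ, t ∈ Ioo a b → ∃ v : ℂ,
    Complex.exp (w t) * v ∈ filippov (perturbedCenter h ε) (Complex.exp (w t)) ∧ HasDerivAt w v t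

theorem ae_ne_real (a : ℝ) : ∀ᵐ t : ℝ, t ≠ a := by simp [ae_iff, measure_singleton]

theorem ae_comp_sub {P : ℝ → Prop} (hP : ∀ᵐ t, P t) (c : ℝ) : ∀ᵐ t : ℝ, P (t - c) :=
  (measurePreserving_sub_right volume c).quasiMeasurePreserving.ae hP

namespace IsLiftedArc

variable {h : Zone → Polynomial ℂ} {ε p δ : ℝ}

theorem comp_sub {w : ℝ → ℂ} {a b : ℝ} (hw : IsLiftedArc h ε p δ w a b) (c : ℝ) :
    IsLiftedArc h ε p δ (fun t => w (t - c)) (a + c) (b + c) where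
  lipschitz := by
    refine LipschitzOnWith.of_dist_le_mul fun x hx y hy => ?_
    refine (hw.lipschitz.dist_le_mul (x - c) ⟨by linarith [hx.1], by linarith [hx.2]⟩ (y - c)
      ⟨by linarith [hy.1], by linarith [hy.2]⟩).trans (le_of_eq ?_)
    rw [dist_sub_right]
  strip t ht := hw.strip _ ⟨by linarith [ht.1], by linarith [ht.2]⟩
  ae := by
    filter_upwards [ae_comp_sub hw.ae c] with t ht hmem
    obtain ⟨v, hv, hd⟩ := ht ⟨by linarith [hmem.1], by linarith [hmem.2]⟩
    exact ⟨v, hv, hd.comp_sub_const t c⟩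

/-- Arcs that meet can be concatenated. -/
theorem trans {w₁ w₂ : ℝ → ℂ} {a b c : ℝ} (h₁ : IsLiftedArc h ε p δ w₁ a b)
    (h₂ : IsLiftedArc h ε p δ w₂ b c) (hab : a ≤ b) (hbc : b ≤ c) (hb : w₁ b = w₂ b) :
    IsLiftedArc h ε p δ (fun t => if t ≤ b then w₁ t else w₂ t) a c where
  lipschitz := by
    refine LipschitzOnWith.of_dist_le_mul fun x hx y hy => ?_
    wlog hxy : x ≤ y generalizing x y
    · rw [dist_comm, dist_comm x]
      exact this y hy x hx (le_of_not_ge hxy)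
    by_cases h1 : y ≤ b
    · simp only [hxy.trans h1, h1, if_true]
      exact h₁.lipschitz.dist_le_mul x ⟨hx.1, hxy.trans h1⟩ y ⟨hy.1, h1⟩
    · rw [not_le] at h1
      by_cases h2 : x ≤ b
      · simp only [h2, h1.not_ge, if_true, if_false]
        have e1 := h₁.lipschitz.dist_le_mul x ⟨hx.1, h2⟩ b ⟨hab, le_rfl⟩
        have e2 := h₂.lipschitz.dist_le_mul b ⟨le_rfl, hbc⟩ y ⟨h1.le, hy.2⟩
        rw [hb] at e1
        have e3 := dist_triangle (w₁ x) (w₂ b) (w₂ y)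
        have e4 : dist x y = dist x b + dist b y := by
          rw [dist_comm x y, dist_comm x b, dist_comm b y, Real.dist_eq, Real.dist_eq, Real.dist_eq,
            abs_of_nonneg (by linarith), abs_of_nonneg (by linarith), abs_of_nonneg (by linarith)]
          ring
        rw [e4, mul_add]
        linarith
      · simp only [h2, h1.not_ge, if_false]
        exact h₂.lipschitz.dist_le_mul x ⟨(not_le.1 h2).le, hx.2⟩ y ⟨h1.le, hy.2⟩
  strip t ht := by
    by_cases h1 : t ≤ b
    · simp only [h1, if_true]
      exact h₁.strip t ⟨ht.1, h1⟩
    · simp only [h1, if_false]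
      exact h₂.strip t ⟨(not_le.1 h1).le, ht.2⟩
  ae := by
    filter_upwards [h₁.ae, h₂.ae, ae_ne_real b] with t ht1 ht2 htb hmem
    rcases lt_or_gt_of_ne htb with h3 | h3
    · obtain ⟨v, hv, hd⟩ := ht1 ⟨hmem.1, h3⟩
      simp only [h3.le, if_true]
      refine ⟨v, hv, hd.congr_of_eventuallyEq ?_⟩
      filter_upwards [Iio_mem_nhds h3] with s hs
      simp [(mem_Iio.1 hs).le]
    · obtain ⟨v, hv, hd⟩ := ht2 ⟨h3, hmem.2⟩
      simp only [h3.not_ge, if_false]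
      refine ⟨v, hv, hd.congr_of_eventuallyEq ?_⟩
      filter_upwards [Ioi_mem_nhds h3] with s hs
      simp [(mem_Ioi.1 hs)]

end IsLiftedArc

/-- The periodic extension of a Lipschitz loop is Lipschitz. -/
theorem LipschitzOnWith.comp_toIcoMod {f : ℝ → ℂ} {K : ℝ≥0} {T : ℝ} (hT : 0 < T)
    (hf : LipschitzOnWith K f (Icc 0 T)) (h0 : f T = f 0) :
    LipschitzWith K fun t => f (toIcoMod hT 0 t) := by
  refine LipschitzWith.of_dist_le_mul fun x y => ?_
  wlog hxy : x ≤ y generalizing x y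
  · rw [dist_comm, dist_comm x]
    exact this y x (le_of_not_ge hxy)
  have hx := toIcoMod_mem_Ico' hT x
  have hy := toIcoMod_mem_Ico' hT y
  have ex := toIcoMod_add_toIcoDiv_zsmul hT 0 x
  have ey := toIcoMod_add_toIcoDiv_zsmul hT 0 y
  rw [zsmul_eq_mul] at ex ey
  set u := toIcoMod hT 0 x
  set v := toIcoMod hT 0 y
  set m := toIcoDiv hT 0 x
  set n := toIcoDiv hT 0 y
  rw [dist_comm x y, Real.dist_eq, abs_of_nonneg (sub_nonneg.2 hxy)]
  rcases lt_trichotomy m n with hmn | hmn | hmn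
  · have hmn' : (m : ℝ) + 1 ≤ n := by exact_mod_cast hmn
    have e1 := hf.dist_le_mul u ⟨hx.1, hx.2.le⟩ T ⟨hT.le, le_rfl⟩
    have e2 := hf.dist_le_mul 0 ⟨le_rfl, hT.le⟩ v ⟨hy.1, hy.2.le⟩
    rw [dist_comm u, Real.dist_eq, abs_of_nonneg (by linarith [hx.2]), h0] at e1
    rw [dist_comm 0 v, Real.dist_eq, abs_of_nonneg (by linarith [hy.1])] at e2
    have e3 := dist_triangle (f u) (f 0) (f v)
    have e4 : (T - u) + (v - 0) ≤ y - x := by nlinarith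
    have e5 := mul_le_mul_of_nonneg_left e4 K.2
    change (K : ℝ) * _ ≤ K * _ at e5
    linarith
  · have e1 := hf.dist_le_mul u ⟨hx.1, hx.2.le⟩ v ⟨hy.1, hy.2.le⟩
    rw [dist_comm u v, Real.dist_eq] at e1
    have e6 : v - u = y - x := by rw [← ex, ← ey, hmn]; ring
    rwa [e6, abs_of_nonneg (sub_nonneg.2 hxy)] at e1
  · have hmn' : (n : ℝ) + 1 ≤ m := by exact_mod_cast hmn
    have := hx.1
    have := hy.2
    nlinarith

namespace IsFrame

variable {h : Zone → Polynomial ℂ} {H : Zone → ℂ → ℂ} {ε p δ L κ : ℝ}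

/-- Consecutive crossings of an orbit chain are joined by an arc. -/
theorem exists_liftedArc (hF : IsFrame h H ε p δ L κ) {q : ℕ → ℝ} (hq : IsOrbitChain H q)
    (hqp : ∀ j ≤ 4, |q j - p| ≤ δ / 2) {j : ℕ} (hj : j < 4) :
    ∃ (w : ℝ → ℂ) (τ : ℝ), 0 < τ ∧ IsLiftedArc h ε p δ w 0 τ ∧ w 0 = cutPoint j (q j) ∧
      w τ = cutPoint (j + 1) (q (j + 1)) := by
  have hδ0 : 0 ≤ δ / 2 := (abs_nonneg _).trans (hqp 0 (by norm_num))
  have hqJ : ∀ j ≤ 4, q j ∈ Icc (p - δ) (p + δ) := fun j hj => by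
    have := abs_le.1 (hqp j hj)
    exact ⟨by linarith [this.1], by linarith [this.2]⟩
  have hκ := hF.κ_le
  have hfl := hF.flow (zoneAt j)
  have hP := hF.cutPoint_mem_ball hj.le (hqJ j hj.le)
  have hP' := hF.cutPoint_mem_ball (j := j + 1) hj (hqJ (j + 1) hj)
  set P := cutPoint j (q j) with hPdef
  set P' := cutPoint (j + 1) (q (j + 1)) with hPdef'
  have hlen := hq.flowCoordinate_eq hj
  rw [← hPdef, ← hPdef'] at hlen
  set τ := arcTime H q j
  have him : 0 < (P' - P).im := by
    have := cut_lt_cut hj (hF.pos_of_mem (hqJ j hj.le)) (hF.pos_of_mem (hqJ (j + 1) hj))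
    simpa [hPdef, hPdef', cutPoint] using this
  have him8 : (P' - P).im ≤ 8 := by
    have h1 := cut_pos hj.le (hF.pos_of_mem (hqJ j hj.le))
    have h2 := cut_le (j := j + 1) hj (hF.pos_of_mem (hqJ (j + 1) hj))
    have := Real.pi_lt_d2
    simp only [hPdef, hPdef', cutPoint, Complex.sub_im]
    linarith
  -- Since `H` is close to the identity, the time of the arc is close to its angle.
  have hnear := hfl.near_id _ hP' _ hP
  rw [hlen, add_sub_cancel_left] at hnear
  have hre := (Complex.abs_re_le_norm _).trans hnear
  have him' := (Complex.abs_im_le_norm _).trans hnear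
  have hκn : κ * ‖P' - P‖ ≤ 1 / 4 * ‖P' - P‖ := by gcongr
  have hn := Complex.norm_le_abs_re_add_abs_im (P' - P)
  rw [abs_of_pos him] at hn
  simp only [Complex.sub_re (Complex.I * _), Complex.sub_im (Complex.I * _), Complex.I_mul_re,
    Complex.I_mul_im, Complex.ofReal_re, Complex.ofReal_im, neg_zero, zero_sub, abs_neg] at hre him'
  have hnorm : ‖P' - P‖ ≤ 4 / 3 * (P' - P).im := by linarith
  have hτ0 : 0 < τ := by linarith [(abs_le.1 him').1]
  have hτ : τ < 20 := by linarith [(abs_le.1 him').2]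
  obtain ⟨w, hw0, hw⟩ := hfl.exists_arc hκ (hF.norm_cutPoint_sub_le hj.le (hqJ j hj.le))
  rw [← hPdef] at hw0 hw
  have hIoo : ∀ s ∈ Icc 0 τ, s ∈ Ioo (-1 : ℝ) 20 := fun s hs =>
    ⟨by linarith [hs.1], by linarith [hs.2]⟩
  have hwτ : w τ = P' := by
    obtain ⟨h1, h2, -⟩ := hw τ (hIoo τ ⟨hτ0.le, le_rfl⟩)
    refine hfl.injOn hκ h1 hP' ?_
    rw [h2, hlen]
  have hstrip : ∀ s ∈ Icc 0 τ, (w s).re ∈ Icc (p - δ) (p + δ) := by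
    intro s hs
    obtain ⟨h1, h2, -⟩ := hw s (hIoo s hs)
    have h3 := hfl.near_id _ h1 _ hP
    rw [h2, add_sub_cancel_left] at h3
    have h4 := (Complex.abs_re_le_norm _).trans h3
    have h5 := norm_sub_norm_le (w s - P) (Complex.I * s)
    rw [norm_sub_rev (w s - P), norm_mul, Complex.norm_I, one_mul, Complex.norm_real,
      Real.norm_eq_abs, abs_of_nonneg hs.1] at h5
    have h6 : κ * ‖w s - P‖ ≤ 1 / 4 * ‖w s - P‖ := by gcongr
    have h7 : ‖w s - P‖ ≤ 27 := by linarith [hs.2]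
    have hκ0 : 0 ≤ κ := (mul_nonneg (abs_nonneg ε) (norm_nonneg _)).trans
      (hF.field_le .plus P (hqJ j hj.le))
    have h8 : κ * ‖w s - P‖ ≤ κ * 27 := by gcongr
    rw [Complex.sub_re (Complex.I * _)] at h4
    simp only [Complex.sub_re, Complex.I_mul_re, Complex.ofReal_im, neg_zero, zero_sub,
      abs_neg] at h4
    have h9 := abs_le.1 (h4.trans h8)
    have h10 := abs_le.1 (hqp j hj.le)
    have h11 : P.re = q j := rfl
    rw [h11] at h9
    exact ⟨by linarith [hF.κ_le_δ, h9.1, h10.1], by linarith [hF.κ_le_δ, h9.2, h10.2]⟩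
  have hvel : ∀ s ∈ Icc 0 τ, ‖Complex.I + ε * logField (h (zoneAt j)) (w s) - Complex.I‖ ≤ κ := by
    intro s hs
    rw [add_sub_cancel_left, norm_mul, Complex.norm_real, Real.norm_eq_abs]
    exact hF.field_le _ _ (hstrip s hs)
  have hlip : LipschitzOnWith 2 w (Icc 0 τ) := by
    refine (convex_Icc _ _).lipschitzOnWith_of_nnnorm_hasDerivWithin_le
      (fun s hs => (hw s (hIoo s hs)).2.2.hasDerivWithinAt) (fun s hs => ?_)
    rw [← NNReal.coe_le_coe, coe_nnnorm]
    have h2 := norm_sub_norm_le (Complex.I + ε * logField (h (zoneAt j)) (w s)) Complex.I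
    rw [Complex.norm_I] at h2
    have := hvel s hs
    push_cast
    linarith
  have hgrow : ∀ i ≤ 4, ∀ s ∈ Icc 0 τ, ∀ t ∈ Icc 0 τ, s ≤ t →
      1 / 2 * (t - s) ≤ phase i (w t) - phase i (w s) := by
    intro i hi s hs t ht hst
    have hsub : Icc s t ⊆ Icc 0 τ := Icc_subset_Icc hs.1 ht.2
    refine hF.phase_growth hi hst (hlip.mono hsub) (fun r hr => hstrip r (hsub hr)) ?_
    refine Eventually.of_forall fun r hr => ?_
    have hr' := hsub (Ioo_subset_Icc_self hr)
    exact ⟨_, hvel r hr', (hw r (hIoo r hr')).2.2⟩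
  refine ⟨w, τ, hτ0, ⟨hlip, hstrip, Eventually.of_forall fun s hs => ?_⟩, hw0, hwτ⟩
  have hs' := Ioo_subset_Icc_self hs
  have h0 := hgrow j hj.le 0 ⟨le_rfl, hτ0.le⟩ s hs' hs.1.le
  have h1 := hgrow (j + 1) hj s hs' τ ⟨hτ0.le, le_rfl⟩ hs.2.le
  rw [hw0, hPdef, phase_cutPoint] at h0
  rw [hwτ, hPdef', phase_cutPoint] at h1
  refine ⟨_, ?_, (hw s (hIoo s hs')).2.2⟩
  rw [filippov_exp hj (hF.pos_of_mem (hstrip s hs')) (sub_pos.1 (show 0 < phase j (w s) by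
      linarith [hs.1])) (sub_neg.1 (show phase (j + 1) (w s) < 0 by linarith [hs.2])),
    perturbedCenter_exp]
  rfl

/-- A closed orbit chain close to the centre of the strip is traced by a simple periodic
solution. -/
theorem exists_periodic_solution (hF : IsFrame h H ε p δ L κ) {q : ℕ → ℝ} (hq : IsOrbitChain H q)
    (hqp : ∀ j ≤ 4, |q j - p| ≤ δ / 2) (hclosed : q 4 = q 0) :
    ∃ (γ : ℝ → ℂ) (T : ℝ), IsSolution (filippov (perturbedCenter h ε)) γ ∧ 0 < T ∧
      Function.Periodic γ T ∧ InjOn γ (Ico 0 T) ∧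
      ∀ t, ‖γ t‖ ∈ Icc (Real.exp (p - δ)) (Real.exp (p + δ)) := by
  have hglue : ∀ n : ℕ, n < 4 → ∃ (w : ℝ → ℂ) (T : ℝ), 0 < T ∧ IsLiftedArc h ε p δ w 0 T ∧
      w 0 = cutPoint 0 (q 0) ∧ w T = cutPoint (n + 1) (q (n + 1)) := by
    intro n
    induction n with
    | zero => exact fun hn => hF.exists_liftedArc hq hqp hn
    | succ n ih =>
      intro hn
      obtain ⟨w₁, T₁, hT₁, ha₁, h10, h11⟩ := ih (by omega)
      obtain ⟨w₂, T₂, hT₂, ha₂, h20, h21⟩ := hF.exists_liftedArc hq hqp hn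
      have ha₂' := ha₂.comp_sub T₁
      rw [zero_add, add_comm T₂] at ha₂'
      refine ⟨_, T₁ + T₂, by linarith, ha₁.trans ha₂' hT₁.le (by linarith) ?_, ?_, ?_⟩
      · rw [h11, sub_self, h20]
      · simp only [hT₁.le, if_true, h10]
      · have : ¬ T₁ + T₂ ≤ T₁ := by linarith
        simp only [this, if_false, add_sub_cancel_left, h21]
  obtain ⟨w, T, hT, harc, hw0, hwT⟩ := hglue 3 (by norm_num)
  have hper : w T = w 0 + 2 * Real.pi * Complex.I := by
    rw [hw0, hwT, show 3 + 1 = 4 from rfl, hclosed]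
    apply Complex.ext <;> simp [cutPoint, cut_four]
  have hmod : ∀ t, toIcoMod hT 0 t ∈ Icc 0 T := fun t =>
    Ico_subset_Icc_self (toIcoMod_mem_Ico' hT t)
  obtain ⟨R, hR⟩ := (isCompact_Icc (a := (0 : ℝ)) (b := T)).exists_bound_of_continuousOn
    harc.lipschitz.continuousOn
  obtain ⟨M, hM⟩ := (Complex.contDiff_exp (𝕜 := ℝ) (n := 1)).contDiffOn.exists_lipschitzOnWith
    (by decide) (convex_closedBall (0 : ℂ) R) (isCompact_closedBall _ _)
  have hlip : LipschitzWith (M * 2) fun t => Complex.exp (w (toIcoMod hT 0 t)) :=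
    LipschitzOnWith.comp_toIcoMod hT (f := fun t => Complex.exp (w t))
      (hM.comp harc.lipschitz fun t ht => by simpa using hR t ht)
      (by rw [hper, Complex.exp_periodic])
  refine ⟨fun t => Complex.exp (w (toIcoMod hT 0 t)), T, ⟨fun a b =>
    (hlip.lipschitzOnWith (s := uIcc a b)).absolutelyContinuousOnInterval, ?_⟩, hT, ?_, ?_, ?_⟩
  · have hall : ∀ᵐ t : ℝ, ∀ k : ℤ, t - k * T ≠ 0 ∧ (t - k * T ∈ Ioo 0 T → ∃ v : ℂ,
        Complex.exp (w (t - k * T)) * v ∈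
          filippov (perturbedCenter h ε) (Complex.exp (w (t - k * T))) ∧
          HasDerivAt w v (t - k * T)) :=
      ae_all_iff.2 fun k => ae_comp_sub ((ae_ne_real 0).and harc.ae) (k * T)
    filter_upwards [hall] with t ht
    have hmem := toIcoMod_mem_Ico' hT t
    set k := toIcoDiv hT 0 t with hk
    have hkt : toIcoMod hT 0 t = t - k * T := by
      rw [← self_sub_toIcoDiv_zsmul, zsmul_eq_mul]
    rw [hkt] at hmem ⊢
    have hmem' : t - k * T ∈ Ioo 0 T := ⟨lt_of_le_of_ne hmem.1 (ht k).1.symm, hmem.2⟩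
    obtain ⟨v, hv, hd⟩ := (ht k).2 hmem'
    refine ⟨_, hv, ?_⟩
    have hd2 : HasDerivAt (fun s => Complex.exp (w (s - k * T))) _ t :=
      (hd.comp_sub_const t (k * T)).cexp
    refine hd2.congr_of_eventuallyEq ?_
    filter_upwards [(continuous_id.sub continuous_const).continuousAt.preimage_mem_nhds
      (Ioo_mem_nhds hmem'.1 hmem'.2)] with s hs
    have hs' : s - k * T ∈ Ico 0 T := Ioo_subset_Ico_self hs
    congr 2
    rw [← toIcoMod_sub_zsmul hT 0 s k, zsmul_eq_mul]
    exact (toIcoMod_eq_self hT).2 (by simpa using hs')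
  · intro t
    simp only [toIcoMod_add_right]
  · -- Over one period the phase grows by exactly one turn.
    have hgrow : ∀ s ∈ Icc 0 T, ∀ t ∈ Icc 0 T, s ≤ t →
        1 / 2 * (t - s) ≤ phase 0 (w t) - phase 0 (w s) := by
      intro s hs t ht hst
      have hsub : Icc s t ⊆ Icc 0 T := Icc_subset_Icc hs.1 ht.2
      refine hF.phase_growth (by norm_num) hst (harc.lipschitz.mono hsub)
        (fun r hr => harc.strip r (hsub hr)) ?_
      filter_upwards [harc.ae] with r hr hmem
      obtain ⟨v, hv, hd⟩ := hr ⟨hs.1.trans_lt hmem.1, hmem.2.trans_le ht.2⟩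
      exact ⟨v, hF.velocity_near (harc.strip r (hsub (Ioo_subset_Icc_self hmem))) hv, hd⟩
    have h0 : phase 0 (w 0) = 0 := by rw [hw0, phase_cutPoint]
    have hTph : phase 0 (w T) = 2 * Real.pi := by
      have := phase_sub_two_pi_mul 0 (w T) 1
      rw [hper] at this ⊢
      simp only [Int.cast_one, one_mul, add_sub_cancel_right, h0] at this
      linarith
    have hrange : ∀ s ∈ Ico 0 T, 0 ≤ phase 0 (w s) ∧ phase 0 (w s) < 2 * Real.pi := by
      intro s hs
      have h1 := hgrow 0 ⟨le_rfl, hT.le⟩ s ⟨hs.1, hs.2.le⟩ hs.1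
      have h2 := hgrow s ⟨hs.1, hs.2.le⟩ T ⟨hT.le, le_rfl⟩ hs.2.le
      exact ⟨by linarith [hs.1], by linarith [hs.2]⟩
    intro s hs t ht hst
    have es : toIcoMod hT 0 s = s := (toIcoMod_eq_self hT).2 (by simpa using hs)
    have et : toIcoMod hT 0 t = t := (toIcoMod_eq_self hT).2 (by simpa using ht)
    simp only [es, et] at hst
    obtain ⟨n, hn⟩ := Complex.exp_eq_exp_iff_exists_int.1 hst
    have hph := phase_sub_two_pi_mul 0 (w s) n
    rw [hn, add_sub_cancel_right, ← hn] at hph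
    obtain ⟨s1, s2⟩ := hrange s hs
    obtain ⟨t1, t2⟩ := hrange t ht
    have hpi := Real.pi_pos
    have hn0 : n = 0 := by
      have h1 : (n : ℝ) < 1 := by
        by_contra! hcon
        nlinarith
      have h2 : (-1 : ℝ) < n := by
        by_contra! hcon
        nlinarith
      have h1' : n < 1 := by exact_mod_cast h1
      have h2' : -1 < n := by exact_mod_cast h2
      omega
    rw [hn0] at hph
    simp only [Int.cast_zero, zero_mul, sub_zero] at hph
    rcases le_total s t with hle | hle
    · have := hgrow s ⟨hs.1, hs.2.le⟩ t ⟨ht.1, ht.2.le⟩ hle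
      linarith
    · have := hgrow t ⟨ht.1, ht.2.le⟩ s ⟨hs.1, hs.2.le⟩ hle
      linarith
  · intro t
    have := harc.strip _ (hmod t)
    rw [Complex.norm_exp]
    exact ⟨Real.exp_le_exp.2 this.1, Real.exp_le_exp.2 this.2⟩

end IsFrame

/-! ### Limit cycles from closed chains -/

namespace IsFrame

variable {h : Zone → Polynomial ℂ} {H : Zone → ℂ → ℂ} {ε p δ L κ : ℝ}

/-- A closed orbit chain that is the only two-sided sequence of consecutive orbit chains gives a
limit cycle, which stays close to the circle of radius `exp p` and meets every ray. -/
theorem exists_isLimitCycle (hF : IsFrame h H ε p δ L κ) {q : ℕ → ℝ} {r : ℝ}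
    (hq : IsOrbitChain H q) (hclosed : q 4 = q 0) (hqr : ∀ j ≤ 4, |q j - p| ≤ r)
    (hr : r ≤ δ / 2) (hrδ : r + 80 * κ < δ)
    (huniq : ∀ x : ℤ → ℕ → ℝ, (∀ m, IsOrbitChain H (x m)) →
      (∀ m, ∀ j ≤ 4, x m j ∈ Icc (p - δ) (p + δ)) → (∀ m, x m 4 = x (m + 1) 0) →
      ∀ m, ∀ j ≤ 4, x m j = q j) :
    ∃ Γ : Set ℂ, IsLimitCycle (filippov (perturbedCenter h ε)) Γ ∧
      (∀ z ∈ Γ, |Real.log ‖z‖ - p| ≤ r + 80 * κ) ∧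
      ∀ θ : ℝ, ∃ z ∈ Γ, z = ‖z‖ * Complex.exp (θ * Complex.I) := by
  obtain ⟨γ, T, hsol, hT, hperiod, hinj, hann⟩ :=
    hF.exists_periodic_solution hq (fun j hj => (hqr j hj).trans hr) hclosed
  -- All solutions in the annulus, the constructed one included, trace the same set.
  have hall : ∀ γ' : ℝ → ℂ, IsSolution (filippov (perturbedCenter h ε)) γ' →
      (∀ t, ‖γ' t‖ ∈ Icc (Real.exp (p - δ)) (Real.exp (p + δ))) →
      range γ' = orbitSet H p q := by
    intro γ' hs ha
    obtain ⟨w, hw, hstrip, hexp⟩ := hF.exists_lift hs ha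
    rw [← hF.range_eq_orbitSet huniq hw hstrip]
    simp only [hexp]
  have hΓ := hall γ hsol hann
  have hqJ : ∀ j ≤ 4, q j ∈ Icc (p - δ) (p + δ) := fun j hj => by
    have := abs_le.1 ((hqr j hj).trans hr)
    have := (abs_nonneg _).trans ((hqr j hj).trans hr)
    constructor <;> linarith
  have hκ0 : 0 ≤ κ := (mul_nonneg (abs_nonneg ε) (norm_nonneg _)).trans
    (hF.field_le .plus (cutPoint 0 (q 0)) (hqJ 0 (by norm_num)))
  have hnear : ∀ z ∈ range γ, |Real.log ‖z‖ - p| ≤ r + 80 * κ := by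
    rw [hΓ]
    rintro z ⟨j, hj, w, hw, s, hs, hHw, rfl⟩
    have hP := hF.cutPoint_mem_ball hj.le (hqJ j hj.le)
    have h1 := (hF.flow (zoneAt j)).near_id _ hw _ hP
    rw [hHw, add_sub_cancel_left] at h1
    have h2 := (Complex.abs_re_le_norm _).trans h1
    have h3 : ‖w - cutPoint j (q j)‖ ≤ 80 := by
      rw [mem_ball_iff_norm] at hw hP
      have := _root_.norm_sub_le (w - p) (cutPoint j (q j) - p)
      rw [sub_sub_sub_cancel_right] at this
      linarith
    have h4 : κ * ‖w - cutPoint j (q j)‖ ≤ κ * 80 := by gcongr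
    rw [Complex.sub_re (Complex.I * _)] at h2
    simp only [Complex.sub_re, Complex.I_mul_re, Complex.ofReal_im, neg_zero, zero_sub,
      abs_neg] at h2
    have h5 : (cutPoint j (q j)).re = q j := rfl
    rw [h5] at h2
    rw [Complex.norm_exp, Real.log_exp]
    linarith [abs_sub_le w.re (q j) p, hqr j hj.le]
  refine ⟨range γ, ⟨⟨γ, T, hsol, hT, hperiod, hinj, rfl⟩,
    {z | ‖z‖ ∈ Ioo (Real.exp (p - δ)) (Real.exp (p + δ))}, isOpen_Ioo.preimage continuous_norm, ?_,
    ?_⟩, hnear, ?_⟩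
  · intro z hz
    have hz0 : 0 < ‖z‖ := by
      obtain ⟨t, rfl⟩ := hz
      exact (Real.exp_pos _).trans_le (hann t).1
    have := abs_lt.1 ((hnear z hz).trans_lt hrδ)
    exact ⟨(Real.lt_log_iff_exp_lt hz0).1 (by linarith [this.1]),
      (Real.log_lt_iff_lt_exp hz0).1 (by linarith [this.2])⟩
  · rintro Γ' ⟨γ', T', hsol', -, -, -, rfl⟩ hsub
    rw [hΓ]
    exact hall γ' hsol' fun t => Ioo_subset_Icc_self (hsub ⟨t, rfl⟩)
  · intro θ
    obtain ⟨w, hw, hstrip, hexp⟩ := hF.exists_lift hsol hann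
    obtain ⟨t₁, ht₁⟩ := hF.exists_phase_eq hw hstrip (j := 0) (by norm_num) (θ - 8)
    obtain ⟨t₂, ht₂⟩ := hF.exists_phase_eq hw hstrip (j := 0) (by norm_num) θ
    have h1 := cut_le (j := 0) (by norm_num) (hF.pos_of_mem (hstrip t₁))
    have h2 := cut_pos (j := 0) (by norm_num) (hF.pos_of_mem (hstrip t₂))
    have hpi := Real.pi_lt_d2
    obtain ⟨K, hK⟩ := hw.1
    obtain ⟨t, ht⟩ := mem_range_of_exists_le_of_exists_ge
      (Complex.continuous_im.comp hK.continuous) (c := θ)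
      ⟨t₁, by simp only [phase, Function.comp] at ht₁ ⊢; linarith⟩
      ⟨t₂, by simp only [phase, Function.comp] at ht₂ ⊢; linarith⟩
    refine ⟨γ t, ⟨t, rfl⟩, ?_⟩
    rw [← hexp t, Complex.norm_exp, Complex.ofReal_exp, ← Complex.exp_add, ← ht, Function.comp,
      Complex.re_add_im]

end IsFrame

/-- The Melnikov function in the logarithmic coordinate: the sum, over the four arcs of the circle
of radius `exp x`, of the first-order changes of the logarithmic radius; `A σ` is a primitive of the
logarithmic field of zone `σ`. -/
noncomputable def melnikov (A : Zone → ℂ → ℂ) (x : ℝ) : ℝ :=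
  ∑ j ∈ Finset.range 4, ((A (zoneAt j) (cutPoint (j + 1) x)).im - (A (zoneAt j) (cutPoint j x)).im)

theorem logField_sub_two_pi (h : Polynomial ℂ) (w : ℂ) (m : ℤ) :
    logField h (w - m * (2 * Real.pi * Complex.I)) = logField h w := by
  have h1 : Complex.exp (w - m * (2 * Real.pi * Complex.I)) = Complex.exp w := by
    rw [Complex.exp_sub, Complex.exp_int_mul_two_pi_mul_I, div_one]
  have h2 : Complex.exp (-(w - m * (2 * Real.pi * Complex.I))) = Complex.exp (-w) := by
    rw [Complex.exp_neg, h1, Complex.exp_neg]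
  rw [logField, logField, h1, h2]

theorem eventually_mul_abs_lt (X : ℝ) {Y : ℝ} (hY : 0 < Y) : ∀ᶠ ε : ℝ in 𝓝 0, X * |ε| < Y := by
  have : Tendsto (fun ε : ℝ => X * |ε|) (𝓝 0) (𝓝 (X * |0|)) :=
    (continuous_const.mul continuous_abs).tendsto 0
  rw [abs_zero, mul_zero] at this
  exact this.eventually_lt_const hY

/-- The logarithmic field has period `2πi`, so that a bound on a disk that contains a full period of
the strip `|Re w - p| ≤ 1` is a bound on the strip. -/
theorem exists_logField_bound (h : Zone → Polynomial ℂ) (p : ℝ) :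
    ∃ C : ℝ, 1 ≤ C ∧ (∀ σ, ∀ w ∈ Metric.ball (p : ℂ) 40, ‖logField (h σ) w‖ ≤ C) ∧
      ∀ σ, ∀ w : ℂ, |w.re - p| ≤ 1 → ‖logField (h σ) w‖ ≤ C := by
  have hone : ∀ σ, ∃ C : ℝ, ∀ w ∈ Metric.closedBall (p : ℂ) 40, ‖logField (h σ) w‖ ≤ C := fun σ =>
    (isCompact_closedBall _ _).exists_bound_of_continuousOn
      (differentiable_logField (h σ)).continuous.continuousOn
  choose C hC using hone
  set C' := max (max 1 (C .plus)) (max (C .center) (C .minus)) with hC'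
  have hle : ∀ σ, C σ ≤ C' := by
    rintro (_ | _ | _) <;> simp [hC']
  have hball : ∀ σ, ∀ w ∈ Metric.ball (p : ℂ) 40, ‖logField (h σ) w‖ ≤ C' := fun σ w hw =>
    (hC σ w (Metric.ball_subset_closedBall hw)).trans (hle σ)
  refine ⟨C', by simp [hC'], hball, fun σ w hw => ?_⟩
  have hpi := Real.pi_pos
  have hpi2 := Real.pi_lt_d2
  set m : ℤ := ⌊w.im / (2 * Real.pi)⌋
  rw [← logField_sub_two_pi (h σ) w m]
  apply hball
  rw [mem_ball_iff_norm]
  have h1 : (m : ℝ) * (2 * Real.pi) ≤ w.im := by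
    rw [← le_div_iff₀ (by positivity)]
    exact Int.floor_le _
  have h2 : w.im < (m + 1) * (2 * Real.pi) := by
    rw [← div_lt_iff₀ (by positivity)]
    exact Int.lt_floor_add_one _
  refine (Complex.norm_le_abs_re_add_abs_im _).trans_lt ?_
  have hre : |(w - m * (2 * Real.pi * Complex.I) - p).re| ≤ 1 := by simpa using hw
  have him : |(w - m * (2 * Real.pi * Complex.I) - p).im| ≤ 7 := by
    simp only [Complex.sub_im, Complex.mul_im, Complex.mul_re, Complex.ofReal_im, Complex.ofReal_re,
      Complex.I_re, Complex.I_im, Complex.intCast_re, Complex.intCast_im, Complex.re_ofNat,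
      Complex.im_ofNat]
    exact abs_le.2 ⟨by linarith, by linarith⟩
  linarith

theorem exists_deriv_cut_bound {p δ : ℝ} (hδ : δ < p) :
    ∃ L : ℝ, 0 ≤ L ∧ ∀ j ≤ 4, ∀ x ∈ Icc (p - δ) (p + δ), |deriv (cut j) x| ≤ L := by
  have hone : ∀ j : ℕ, ∃ L : ℝ, j ≤ 4 → ∀ x ∈ Icc (p - δ) (p + δ), |deriv (cut j) x| ≤ L := by
    intro j
    by_cases hj : j ≤ 4
    · have hcd : ContDiffOn ℝ 1 (cut j) (Ioi 0) := fun x hx =>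
        (contDiffAt_cut hj hx).contDiffWithinAt
      have hc := (hcd.continuousOn_deriv_of_isOpen isOpen_Ioi le_rfl).mono
        (show Icc (p - δ) (p + δ) ⊆ Ioi 0 from fun x hx => by
          simp only [mem_Ioi]; linarith [hx.1])
      obtain ⟨L, hL⟩ := isCompact_Icc.exists_bound_of_continuousOn hc
      exact ⟨L, fun _ x hx => hL x hx⟩
    · exact ⟨0, fun h => absurd h hj⟩
  choose L hL using hone
  refine ⟨∑ j ∈ Finset.range 5, |L j|, Finset.sum_nonneg fun _ _ => abs_nonneg _,
    fun j hj x hx => ((hL j hj x hx).trans (le_abs_self _)).trans ?_⟩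
  exact Finset.single_le_sum (f := fun j => |L j|) (fun _ _ => abs_nonneg _)
    (Finset.mem_range.2 (by omega))

theorem hasStrictDerivAt_cutPoint {j : ℕ} (hj : j ≤ 4) {x : ℝ} (hx : 0 < x) :
    HasStrictDerivAt (cutPoint j) (1 + deriv (cut j) x * Complex.I) x := by
  have h1 : HasStrictDerivAt (cut j) (deriv (cut j) x) x :=
    (contDiffAt_cut hj hx).hasStrictDerivAt (by norm_num)
  have h2 := (Complex.ofRealCLM.hasStrictFDerivAt.comp_hasStrictDerivAt x
    (hasStrictDerivAt_id x)).add
    ((Complex.ofRealCLM.hasStrictFDerivAt.comp_hasStrictDerivAt x h1).mul_const Complex.I)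
  have h3 : cutPoint j = fun x : ℝ => (x : ℂ) + (cut j x : ℂ) * Complex.I := by
    ext x
    exact Complex.ext (by simp [cutPoint]) (by simp [cutPoint])
  rw [h3]
  exact h2.congr_deriv (by simp)

theorem norm_cutPoint_sub_cutPoint_le {j : ℕ} (hj : j ≤ 4) {p δ L : ℝ} (hδ : δ < p)
    (hL : ∀ x ∈ Icc (p - δ) (p + δ), |deriv (cut j) x| ≤ L) {u v : ℝ}
    (hu : u ∈ Icc (p - δ) (p + δ)) (hv : v ∈ Icc (p - δ) (p + δ)) :
    ‖cutPoint j u - cutPoint j v‖ ≤ (1 + L) * |u - v| := by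
  rw [← Real.norm_eq_abs (u - v)]
  refine (convex_Icc _ _).norm_image_sub_le_of_norm_hasDerivWithin_le (fun x hx =>
    (hasStrictDerivAt_cutPoint hj (by linarith [hx.1] : 0 < x)).hasDerivAt.hasDerivWithinAt)
    (fun x hx => ?_) hv hu
  refine (norm_add_le _ _).trans ?_
  rw [norm_one, norm_mul, Complex.norm_I, mul_one, Complex.norm_real, Real.norm_eq_abs]
  linarith [hL x hx]

/-- A strictly differentiable function is, near the point, linear up to small relative errors. -/
theorem HasStrictDerivAt.eventually_abs_sub_le {f : ℝ → ℝ} {f' p η : ℝ}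
    (hf : HasStrictDerivAt f f' p) (hη : 0 < η) :
    ∀ᶠ δ : ℝ in 𝓝[>] 0, ∀ u ∈ Icc (p - δ) (p + δ), ∀ v ∈ Icc (p - δ) (p + δ),
      |f u - f v - f' * (u - v)| ≤ η * |u - v| := by
  have h1 := hf.isLittleO.def hη
  rw [Metric.eventually_nhds_iff] at h1
  obtain ⟨r, hr, h1⟩ := h1
  filter_upwards [Ioo_mem_nhdsGT hr] with δ hδ u hu v hv
  have h2 := @h1 (u, v) (by
    rw [Prod.dist_eq, max_lt_iff, Real.dist_eq, Real.dist_eq, abs_lt, abs_lt]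
    exact ⟨⟨by linarith [hu.1, hδ.2], by linarith [hu.2, hδ.2]⟩,
      ⟨by linarith [hv.1, hδ.2], by linarith [hv.2, hδ.2]⟩⟩)
  simpa [Real.norm_eq_abs, mul_comm] using h2

/-! ### First-order averaging -/

/-- Joinability by orbit arcs, written out for flow coordinates of the form `w + i ε E w`: the real
part of such a coordinate at a point with logarithmic radius `y` is `y - ε Im E`. -/
theorem isOrbitChain_iff {E : Zone → ℂ → ℂ} {ε : ℝ} {x : ℕ → ℝ} :
    IsOrbitChain (fun σ w => w + Complex.I * ε * E σ w) x ↔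
      IsCrossingChain ε (fun j y => (E (zoneAt j) (cutPoint j y)).im)
        (fun j y => (E (zoneAt j) (cutPoint (j + 1) y)).im) x := by
  have key : ∀ (σ : Zone) (j : ℕ) (y : ℝ), (cutPoint j y + Complex.I * ε * E σ (cutPoint j y)).re =
      y - ε * (E σ (cutPoint j y)).im := by
    intro σ j y
    simp [cutPoint, sub_eq_add_neg]
  refine forall₂_congr fun j _ => ?_
  simp only [key]
  constructor <;> intro h <;> linarith

theorem hasStrictDerivAt_im_comp_cutPoint {A g : ℂ → ℂ} (hg : Continuous g)
    (hA : ∀ w, HasDerivAt A (g w) w) {j : ℕ} (hj : j ≤ 4) {p : ℝ} (hp : 0 < p) :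
    ∃ c : ℝ, HasStrictDerivAt (fun x => (A (cutPoint j x)).im) c p := by
  have h1 : HasStrictDerivAt A (g (cutPoint j p)) (cutPoint j p) :=
    hasStrictDerivAt_of_hasDerivAt_of_continuousAt (Eventually.of_forall hA) hg.continuousAt
  have h2 := h1.comp p (hasStrictDerivAt_cutPoint hj hp)
  exact ⟨_, Complex.imCLM.hasStrictFDerivAt.comp_hasStrictDerivAt p h2⟩

/-- Isolation of a closed chain `q`: the deviations from `q` of the successive turns of a two-sided
sequence of chains follow a hyperbolic recursion and stay bounded, hence vanish. This needs no
return map: the sequence is only assumed to satisfy the crossing equations `P`. -/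
theorem closed_crossing_chain_eq_of_sub_estimate {J : Set ℝ} {ε m B : ℝ} {q : ℕ → ℝ}
    {P : (ℕ → ℝ) → Prop} (hε : ε ≠ 0) (hm : m ≠ 0) (hεm : |ε * m| ≤ 1) (hclosed : q 4 = q 0)
    (hB : ∀ u ∈ J, |u - q 0| ≤ B)
    (hsub : ∀ x, P x → (∀ j ≤ 4, x j ∈ J) → (∀ j ≤ 4, |x j - q j| ≤ 3 * |x 0 - q 0|) ∧
      |x 4 - q 4 - (x 0 - q 0) - ε * m * (x 0 - q 0)| ≤ |ε| * (|m| / 2) * |x 0 - q 0|)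
    {x : ℤ → ℕ → ℝ} (hx : ∀ k, P (x k)) (hxJ : ∀ k, ∀ j ≤ 4, x k j ∈ J)
    (hnext : ∀ k, x k 4 = x (k + 1) 0) (k : ℤ) {j : ℕ} (hj : j ≤ 4) : x k j = q j := by
  have h0 := eq_zero_of_hyperbolic_recursion (e := fun k => x k 0 - q 0) (μ := ε * m) (B := B)
    (mul_ne_zero hε hm) hεm (fun k => hB _ (hxJ k 0 (by norm_num))) (fun k => by
      have := (hsub _ (hx k) (hxJ k)).2
      rw [hnext k, hclosed] at this
      rw [abs_mul, mul_div_assoc]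
      exact this) k
  have h1 := (hsub _ (hx k) (hxJ k)).1 j hj
  rw [h0, abs_zero, mul_zero] at h1
  exact sub_eq_zero.1 (abs_nonpos_iff.1 h1)

/-- Near `p`, the boundary values of the unperturbed increments are linear up to small relative
errors, with slopes whose alternating sum is the derivative of the Melnikov function. -/
theorem exists_linear_approx {h : Zone → Polynomial ℂ} {A : Zone → ℂ → ℂ}
    (hA : ∀ σ w, HasDerivAt (A σ) (logField (h σ) w) w) {p m : ℝ} (hp : 0 < p)
    (hderiv : HasDerivAt (melnikov A) m p) :
    ∃ a' b' : ℕ → ℝ, ∑ j ∈ Finset.range 4, (b' j - a' j) = m ∧ ∀ η > 0, ∃ δ : ℝ, 0 < δ ∧ δ < p ∧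
      δ ≤ 1 ∧
      (∀ j < 4, ∀ u ∈ Icc (p - δ) (p + δ), ∀ v ∈ Icc (p - δ) (p + δ),
        |(A (zoneAt j) (cutPoint j u)).im - (A (zoneAt j) (cutPoint j v)).im - a' j * (u - v)| ≤
          η * |u - v|) ∧
      (∀ j < 4, ∀ u ∈ Icc (p - δ) (p + δ), ∀ v ∈ Icc (p - δ) (p + δ),
        |(A (zoneAt j) (cutPoint (j + 1) u)).im - (A (zoneAt j) (cutPoint (j + 1) v)).im -
          b' j * (u - v)| ≤ η * |u - v|) := by
  have hexa : ∀ j : ℕ, ∃ c : ℝ, j < 4 →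
      HasStrictDerivAt (fun x => (A (zoneAt j) (cutPoint j x)).im) c p := fun j => by
    by_cases hj : j < 4
    · obtain ⟨c, hc⟩ := hasStrictDerivAt_im_comp_cutPoint
        (differentiable_logField (h (zoneAt j))).continuous (hA _) hj.le hp
      exact ⟨c, fun _ => hc⟩
    · exact ⟨0, fun h => absurd h hj⟩
  have hexb : ∀ j : ℕ, ∃ c : ℝ, j < 4 →
      HasStrictDerivAt (fun x => (A (zoneAt j) (cutPoint (j + 1) x)).im) c p := fun j => by
    by_cases hj : j < 4
    · obtain ⟨c, hc⟩ := hasStrictDerivAt_im_comp_cutPoint (j := j + 1)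
        (differentiable_logField (h (zoneAt j))).continuous (hA _) hj hp
      exact ⟨c, fun _ => hc⟩
    · exact ⟨0, fun h => absurd h hj⟩
  choose a' ha' using hexa
  choose b' hb' using hexb
  have hm' : ∑ j ∈ Finset.range 4, (b' j - a' j) = m := by
    refine HasDerivAt.unique ?_ hderiv
    unfold melnikov
    exact HasDerivAt.fun_sum fun j hj => (hb' j (Finset.mem_range.1 hj)).hasDerivAt.sub
      (ha' j (Finset.mem_range.1 hj)).hasDerivAt
  refine ⟨a', b', hm', fun η hη0 => ?_⟩
  have e1 : ∀ᶠ δ : ℝ in 𝓝[>] 0, δ ∈ Ioo 0 (min p 1) :=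
    Ioo_mem_nhdsGT (lt_min hp one_pos)
  have e2 := (Finset.eventually_all (Finset.range 4)).2 fun j hj =>
    (ha' j (Finset.mem_range.1 hj)).eventually_abs_sub_le hη0
  have e3 := (Finset.eventually_all (Finset.range 4)).2 fun j hj =>
    (hb' j (Finset.mem_range.1 hj)).eventually_abs_sub_le hη0
  obtain ⟨δ, h1, h2, h3⟩ := (e1.and (e2.and e3)).exists
  exact ⟨δ, h1.1, h1.2.trans_le (min_le_left _ _), (h1.2.trans_le (min_le_right _ _)).le,
    fun j hj => h2 j (Finset.mem_range.2 hj), fun j hj => h3 j (Finset.mem_range.2 hj)⟩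

/-- The limit cycle at one value of `ε` that is small compared with the constants of the strip: `C`
bounds the logarithmic fields, `L` the slopes of the cuts, `K` the slopes of the boundary values,
and `N` the increments along the arcs. The hypotheses `s1` to `s8` say how small. -/
theorem exists_isLimitCycle_of_small {h : Zone → Polynomial ℂ} {A : Zone → ℂ → ℂ}
    (hA : ∀ σ w, HasDerivAt (A σ) (logField (h σ) w) w) {p m C K L δ η N c₁ ε : ℝ} {a' b' : ℕ → ℝ}
    (hm : m ≠ 0) (hzero : melnikov A p = 0) (hC1 : 1 ≤ C)
    (hCball : ∀ σ, ∀ w ∈ Metric.ball (p : ℂ) 40, ‖logField (h σ) w‖ ≤ C)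
    (hCstrip : ∀ σ, ∀ w : ℂ, |w.re - p| ≤ 1 → ‖logField (h σ) w‖ ≤ C)
    (hm' : ∑ j ∈ Finset.range 4, (b' j - a' j) = m) (hK1 : 1 ≤ K)
    (hKa : ∀ j < 4, |a' j| ≤ K) (hKb : ∀ j < 4, |b' j| ≤ K)
    (hη0 : 0 < η) (hη1 : η ≤ 1 / 2) (hη2 : η ≤ |m| / 192)
    (hδ0 : 0 < δ) (hδp : δ < p) (hδ1 : δ ≤ 1)
    (hδa : ∀ j < 4, ∀ u ∈ Icc (p - δ) (p + δ), ∀ v ∈ Icc (p - δ) (p + δ),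
      |(A (zoneAt j) (cutPoint j u)).im - (A (zoneAt j) (cutPoint j v)).im - a' j * (u - v)| ≤
        η * |u - v|)
    (hδb : ∀ j < 4, ∀ u ∈ Icc (p - δ) (p + δ), ∀ v ∈ Icc (p - δ) (p + δ),
      |(A (zoneAt j) (cutPoint (j + 1) u)).im - (A (zoneAt j) (cutPoint (j + 1) v)).im -
        b' j * (u - v)| ≤ η * |u - v|)
    (hL : ∀ j ≤ 4, ∀ x ∈ Icc (p - δ) (p + δ), |deriv (cut j) x| ≤ L)
    (hN : N = 48 * C) (hc₁ : c₁ = 2 / |m| * (64 * K * N + 192 * C ^ 2)) (hε : ε ≠ 0)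
    (s1 : C * |ε| < 1 / 2) (s2 : 2 * C * (1 + L) * |ε| < 1 / 2) (s3 : 108 * C * |ε| < δ)
    (s4 : 2 * C ^ 2 * (1 + L) * |ε| < η) (s5 : K * |ε| < 1 / 16)
    (s6 : 384 * K ^ 2 * |ε| < |m| / 4) (s7 : |m| * |ε| < 1)
    (s8 : (c₁ + 4 * N + 160 * C) * |ε| < δ / 2) :
    ∃ Γ : Set ℂ, IsLimitCycle (filippov (perturbedCenter h ε)) Γ ∧
      (∀ z ∈ Γ, |Real.log ‖z‖ - p| ≤ (c₁ + 4 * N + 160 * C) * |ε|) ∧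
      ∀ θ : ℝ, ∃ z ∈ Γ, z = ‖z‖ * Complex.exp (θ * Complex.I) := by
  have hm0 : 0 < |m| := abs_pos.2 hm
  have hC0 : 0 < C := by linarith
  have hN0 : 0 ≤ N := by rw [hN]; positivity
  have hc₁0 : 0 ≤ c₁ := by rw [hc₁]; positivity
  have hε0 : 0 < |ε| := abs_pos.2 hε
  have hexB := fun σ => exists_isFlowCoordinate (differentiable_logField (h σ)).differentiableOn
    (hCball σ) (fun w _ => hA σ w) (ε := ε) (by linarith)
  choose B hBlip hBflow using hexB
  have hCε : 0 ≤ C * |ε| := by positivity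
  have hNε : 0 ≤ |ε| * N := by positivity
  have hcε : 0 ≤ c₁ * |ε| := by positivity
  have hrad' : c₁ * |ε| + 4 * (|ε| * N) + 160 * (C * |ε|) < δ / 2 := by linarith
  set J := Icc (p - δ) (p + δ) with hJ
  have hF : IsFrame h (fun σ w => w + Complex.I * ε * (A σ w + B σ w)) ε p δ L (2 * C * |ε|) := {
    δ_lt := hδp
    δ_le := hδ1
    abs_deriv_cut_le := hL
    flow := hBflow
    field_le := fun σ w hw => by
      have := hCstrip σ w (abs_le.2 ⟨by linarith [hw.1], by linarith [hw.2]⟩)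
      nlinarith
    κ_mul_le := by linarith
    κ_le_δ := by linarith }
  have hpJ : p ∈ J := ⟨by linarith, by linarith⟩
  have hball : ∀ j ≤ 4, ∀ u ∈ J, cutPoint j u ∈ Metric.ball (p : ℂ) 40 := fun j hj u hu =>
    hF.cutPoint_mem_ball hj hu
  have hdist : ∀ i ≤ 4, ∀ j ≤ 4, ∀ u ∈ J, ∀ v ∈ J, ‖cutPoint i u - cutPoint j v‖ ≤ 24 := by
    intro i hi j hj u hu v hv
    have h1 := hF.norm_cutPoint_sub_le hi hu
    have h2 := hF.norm_cutPoint_sub_le hj hv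
    have h3 := norm_sub_le (cutPoint i u - p) (cutPoint j v - p)
    rw [sub_sub_sub_cancel_right] at h3
    linarith
  -- The correction `B` has a small Lipschitz constant along the cuts.
  have hBcut : ∀ σ, ∀ j ≤ 4, ∀ u ∈ J, ∀ v ∈ J,
      |(B σ (cutPoint j u)).im - (B σ (cutPoint j v)).im| ≤ η * |u - v| := by
    intro σ j hj u hu v hv
    rw [← Complex.sub_im]
    refine (Complex.abs_im_le_norm _).trans
      ((hBlip σ _ (hball j hj u hu) _ (hball j hj v hv)).trans ?_)
    have h1 := norm_cutPoint_sub_cutPoint_le hj hδp (hL j hj) hu hv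
    calc 2 * C ^ 2 * |ε| * ‖cutPoint j u - cutPoint j v‖
        ≤ 2 * C ^ 2 * |ε| * ((1 + L) * |u - v|) := by gcongr
      _ = 2 * C ^ 2 * (1 + L) * |ε| * |u - v| := by ring
      _ ≤ η * |u - v| := by gcongr
  set a : ℕ → ℝ → ℝ := fun j y =>
    (A (zoneAt j) (cutPoint j y) + B (zoneAt j) (cutPoint j y)).im with ha
  set b : ℕ → ℝ → ℝ := fun j y =>
    (A (zoneAt j) (cutPoint (j + 1) y) + B (zoneAt j) (cutPoint (j + 1) y)).im with hb
  have haest : ∀ j < 4, ∀ u ∈ J, ∀ v ∈ J, |a j u - a j v - a' j * (u - v)| ≤ 2 * η * |u - v| := by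
    intro j hj u hu v hv
    have h1 := hδa j hj u hu v hv
    have h2 := hBcut (zoneAt j) j hj.le u hu v hv
    have h3 := (abs_add_le _ _).trans (add_le_add h1 h2)
    refine le_trans (le_of_eq ?_) (h3.trans (le_of_eq (by ring)))
    simp only [ha, Complex.add_im]
    congr 1
    ring
  have hbest : ∀ j < 4, ∀ u ∈ J, ∀ v ∈ J, |b j u - b j v - b' j * (u - v)| ≤ 2 * η * |u - v| := by
    intro j hj u hu v hv
    have h1 := hδb j hj u hu v hv
    have h2 := hBcut (zoneAt j) (j + 1) hj u hu v hv
    have h3 := (abs_add_le _ _).trans (add_le_add h1 h2)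
    refine le_trans (le_of_eq ?_) (h3.trans (le_of_eq (by ring)))
    simp only [hb, Complex.add_im]
    congr 1
    ring
  have hAlip : ∀ σ, ∀ u ∈ Metric.ball (p : ℂ) 40, ∀ v ∈ Metric.ball (p : ℂ) 40,
      ‖A σ u - A σ v‖ ≤ C * ‖u - v‖ := fun σ u hu v hv =>
    (convex_ball _ _).norm_image_sub_le_of_norm_hasDerivWithin_le
      (fun w _ => (hA σ w).hasDerivWithinAt) (hCball σ) hv hu
  have hNab : ∀ j < 4, ∀ u ∈ J, ∀ v ∈ J, |b j u - a j v| ≤ N := by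
    intro j hj u hu v hv
    have hu' := hball (j + 1) hj u hu
    have hv' := hball j hj.le v hv
    have h1 := hAlip (zoneAt j) _ hu' _ hv'
    have h2 := hBlip (zoneAt j) _ hu' _ hv'
    have h3 := hdist (j + 1) hj j hj.le u hu v hv
    have h4 := norm_nonneg (cutPoint (j + 1) u - cutPoint j v)
    have h5 : 2 * C ^ 2 * |ε| * ‖cutPoint (j + 1) u - cutPoint j v‖ ≤
        C * ‖cutPoint (j + 1) u - cutPoint j v‖ := by
      gcongr
      nlinarith
    have h6 : C * ‖cutPoint (j + 1) u - cutPoint j v‖ ≤ C * 24 := by gcongr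
    simp only [ha, hb]
    rw [← Complex.sub_im, add_sub_add_comm]
    have h7 := (Complex.abs_im_le_norm _).trans ((norm_add_le _ _).trans (add_le_add h1 h2))
    refine h7.trans ?_
    rw [hN]
    linarith
  have hsub : ∀ x y : ℕ → ℝ, IsCrossingChain ε a b x → IsCrossingChain ε a b y →
      (∀ j ≤ 4, x j ∈ J) → (∀ j ≤ 4, y j ∈ J) → (∀ j ≤ 4, |x j - y j| ≤ 3 * |x 0 - y 0|) ∧
      |x 4 - y 4 - (x 0 - y 0) - ε * m * (x 0 - y 0)| ≤ |ε| * (|m| / 2) * |x 0 - y 0| := by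
    intro x y hx hy hxJ hyJ
    obtain ⟨e1, e2⟩ := hx.sub_estimate haest hbest hKa hKb (by linarith) (by linarith)
      (by linarith) hy hxJ hyJ
    refine ⟨e1, ?_⟩
    rw [hm'] at e2
    refine e2.trans ?_
    gcongr
    linarith
  have hbcont : ∀ j < 4, ContinuousOn (b j) J := by
    intro j hj
    refine (LipschitzOnWith.of_dist_le_mul (K := ⟨2 * K, by linarith⟩)
      fun u hu v hv => ?_).continuousOn
    exact abs_sub_le_of_abs_sub_linear_le (hKb j hj) (by linarith) (hbest j hj u hu v hv)
  -- From `p` the first-order part of the return displacement is the Melnikov function, which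
  -- vanishes there, and the rest is of second order.
  have hstart : ∀ x : ℕ → ℝ, IsCrossingChain ε a b x → x 0 = p →
      (∀ j ≤ 4, |x j - p| ≤ 4 * (|ε| * N)) → |x 4 - x 0| ≤ |ε| * (|m| / 2 * (c₁ * |ε|)) := by
    intro x hx hx0 hxp
    have hr : 4 * (|ε| * N) ≤ δ := by linarith
    have hxJ : ∀ j ≤ 4, x j ∈ J := fun j hj => by
      have := abs_le.1 ((hxp j hj).trans hr)
      exact ⟨by linarith [this.1], by linarith [this.2]⟩
    have hsum : x 4 - x 0 = ε * ∑ j ∈ Finset.range 4, (b j (x (j + 1)) - a j (x j)) := by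
      rw [Finset.mul_sum, ← Finset.sum_range_sub x]
      exact Finset.sum_congr rfl fun j hj => hx j (Finset.mem_range.1 hj)
    have hsum' : ∑ j ∈ Finset.range 4, (b j (x (j + 1)) - a j (x j)) =
        ∑ j ∈ Finset.range 4, (b j (x (j + 1)) - a j (x j) -
          ((A (zoneAt j) (cutPoint (j + 1) p)).im - (A (zoneAt j) (cutPoint j p)).im)) := by
      rw [Finset.sum_sub_distrib _ (fun j => (A (zoneAt j) (cutPoint (j + 1) p)).im -
        (A (zoneAt j) (cutPoint j p)).im)]
      change _ = _ - melnikov A p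
      rw [hzero, sub_zero]
    have hterm : ∀ j ∈ Finset.range 4, |b j (x (j + 1)) - a j (x j) -
        ((A (zoneAt j) (cutPoint (j + 1) p)).im - (A (zoneAt j) (cutPoint j p)).im)| ≤
        (16 * K * N + 48 * C ^ 2) * |ε| := by
      intro j hj
      rw [Finset.mem_range] at hj
      have h1 := abs_sub_le_of_abs_sub_linear_le (hKb j hj) (by linarith)
        (hbest j hj _ (hxJ (j + 1) hj) _ hpJ)
      have h2 := abs_sub_le_of_abs_sub_linear_le (hKa j hj) (by linarith)
        (haest j hj _ (hxJ j hj.le) _ hpJ)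
      have h3 := (Complex.abs_im_le_norm _).trans
        (hBlip (zoneAt j) _ (hball (j + 1) hj p hpJ) _ (hball j hj.le p hpJ))
      have h4 : 2 * C ^ 2 * |ε| * ‖cutPoint (j + 1) p - cutPoint j p‖ ≤ 2 * C ^ 2 * |ε| * 24 := by
        gcongr
        exact hdist (j + 1) hj j hj.le p hpJ p hpJ
      have h5 : 2 * K * |x (j + 1) - p| ≤ 2 * K * (4 * (|ε| * N)) := by
        gcongr
        exact hxp (j + 1) hj
      have h6 : 2 * K * |x j - p| ≤ 2 * K * (4 * (|ε| * N)) := by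
        gcongr
        exact hxp j hj.le
      have h7 := abs_add_le (b j (x (j + 1)) - b j p - (a j (x j) - a j p))
        (B (zoneAt j) (cutPoint (j + 1) p) - B (zoneAt j) (cutPoint j p)).im
      have h8 := abs_sub (b j (x (j + 1)) - b j p) (a j (x j) - a j p)
      rw [show b j (x (j + 1)) - b j p - (a j (x j) - a j p) +
        (B (zoneAt j) (cutPoint (j + 1) p) - B (zoneAt j) (cutPoint j p)).im =
        b j (x (j + 1)) - a j (x j) -
        ((A (zoneAt j) (cutPoint (j + 1) p)).im - (A (zoneAt j) (cutPoint j p)).im) by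
          simp only [ha, hb, Complex.add_im, Complex.sub_im]; ring] at h7
      linarith
    rw [hsum, hsum', abs_mul]
    gcongr
    refine (Finset.abs_sum_le_sum_abs _ _).trans ((Finset.sum_le_card_nsmul _ _ _ hterm).trans ?_)
    rw [Finset.card_range, nsmul_eq_mul, hc₁]
    apply le_of_eq
    field_simp
    push_cast
    ring
  obtain ⟨q, hq, hq4, hqp⟩ := exists_closed_isCrossingChain hε hm hbcont hN0 hNab
    (fun x y hx hy hxJ hyJ => (hsub x y hx hy hxJ hyJ).2) hstart hcε (by linarith)
  have hrad : c₁ * |ε| + 4 * (|ε| * N) ≤ δ / 2 := by linarith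
  have hqJ : ∀ j ≤ 4, q j ∈ J := fun j hj => by
    have := abs_le.1 ((hqp j hj).trans hrad)
    exact ⟨by linarith [this.1], by linarith [this.2]⟩
  obtain ⟨Γ, hΓ, hnear, hray⟩ := hF.exists_isLimitCycle
    ((isOrbitChain_iff (E := fun σ w => A σ w + B σ w)).2 hq) hq4 hqp hrad (by linarith)
    (fun x hx hxJ hnext k j hj => closed_crossing_chain_eq_of_sub_estimate hε hm
      (by rw [abs_mul]; linarith) hq4 (B := 2 * δ)
      (fun u hu => by
        have := hqJ 0 (by norm_num)
        exact abs_le.2 ⟨by linarith [hu.1, this.2], by linarith [hu.2, this.1]⟩)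
      (fun y hy hyJ => hsub y q hy hq hyJ hqJ)
      (fun k => (isOrbitChain_iff (E := fun σ w => A σ w + B σ w)).1 (hx k)) hxJ hnext k hj)
  refine ⟨Γ, hΓ, fun z hz => (hnear z hz).trans (le_of_eq ?_), hray⟩
  ring

/-- **First-order averaging.** At a simple zero `p` of the Melnikov function, the perturbed system
has for every small `ε ≠ 0` a limit cycle at distance `O(ε)` from the circle of radius `exp p`. -/
theorem exists_isLimitCycle_of_simple_zero {h : Zone → Polynomial ℂ} {A : Zone → ℂ → ℂ}
    (hA : ∀ σ w, HasDerivAt (A σ) (logField (h σ) w) w) {p m : ℝ} (hp : 0 < p) (hm : m ≠ 0)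
    (hzero : melnikov A p = 0) (hderiv : HasDerivAt (melnikov A) m p) :
    ∃ c : ℝ, ∀ᶠ ε : ℝ in 𝓝[≠] 0, ∃ Γ : Set ℂ,
      IsLimitCycle (filippov (perturbedCenter h ε)) Γ ∧ (∀ z ∈ Γ, |Real.log ‖z‖ - p| ≤ c * |ε|) ∧
      ∀ θ : ℝ, ∃ z ∈ Γ, z = ‖z‖ * Complex.exp (θ * Complex.I) := by
  obtain ⟨C, hC1, hCball, hCstrip⟩ := exists_logField_bound h p
  obtain ⟨a', b', hm', hstrip⟩ := exists_linear_approx hA hp hderiv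
  have hm0 : 0 < |m| := abs_pos.2 hm
  set K : ℝ := 1 + ∑ j ∈ Finset.range 4, (|a' j| + |b' j|) with hK
  have hK1 : 1 ≤ K := by
    have : 0 ≤ ∑ j ∈ Finset.range 4, (|a' j| + |b' j|) :=
      Finset.sum_nonneg fun _ _ => by positivity
    linarith
  have hKab : ∀ j < 4, |a' j| + |b' j| ≤ K := by
    intro j hj
    have := Finset.single_le_sum (f := fun j => |a' j| + |b' j|) (fun _ _ => by positivity)
      (Finset.mem_range.2 hj)
    linarith
  have hKa : ∀ j < 4, |a' j| ≤ K := fun j hj => by linarith [hKab j hj, abs_nonneg (b' j)]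
  have hKb : ∀ j < 4, |b' j| ≤ K := fun j hj => by linarith [hKab j hj, abs_nonneg (a' j)]
  set η : ℝ := min (1 / 2) (|m| / 192) with hη
  have hη0 : 0 < η := lt_min (by norm_num) (by positivity)
  have hη1 : η ≤ 1 / 2 := min_le_left _ _
  have hη2 : η ≤ |m| / 192 := min_le_right _ _
  obtain ⟨δ, hδ0, hδp, hδ1, hδa, hδb⟩ := hstrip η hη0
  obtain ⟨L, hL0, hL⟩ := exists_deriv_cut_bound hδp
  set N : ℝ := 48 * C with hN
  set c₁ : ℝ := 2 / |m| * (64 * K * N + 192 * C ^ 2) with hc₁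
  refine ⟨c₁ + 4 * N + 160 * C, ?_⟩
  filter_upwards [self_mem_nhdsWithin,
    nhdsWithin_le_nhds (eventually_mul_abs_lt C (show (0 : ℝ) < 1 / 2 by norm_num)),
    nhdsWithin_le_nhds (eventually_mul_abs_lt (2 * C * (1 + L)) (show (0 : ℝ) < 1 / 2 by norm_num)),
    nhdsWithin_le_nhds (eventually_mul_abs_lt (108 * C) hδ0),
    nhdsWithin_le_nhds (eventually_mul_abs_lt (2 * C ^ 2 * (1 + L)) hη0),
    nhdsWithin_le_nhds (eventually_mul_abs_lt K (show (0 : ℝ) < 1 / 16 by norm_num)),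
    nhdsWithin_le_nhds (eventually_mul_abs_lt (384 * K ^ 2) (show 0 < |m| / 4 by positivity)),
    nhdsWithin_le_nhds (eventually_mul_abs_lt |m| one_pos),
    nhdsWithin_le_nhds (eventually_mul_abs_lt (c₁ + 4 * N + 160 * C)
      (show 0 < δ / 2 by positivity))]
    with ε hε s1 s2 s3 s4 s5 s6 s7 s8
  exact exists_isLimitCycle_of_small hA hm hzero hC1 hCball hCstrip hm' hK1 hKa hKb hη0 hη1 hη2
    hδ0 hδp hδ1 hδa hδb hL hN hc₁ hε s1 s2 s3 s4 s5 s6 s7 s8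

/-! ### A quartic perturbation with four simple zeros -/

/-- The quartic `i b₀ + a z + i b₂ z² + i b₄ z⁴`. -/
noncomputable def quartic (a b₀ b₂ b₄ : ℝ) : Polynomial ℂ :=
  Polynomial.C (Complex.I * b₀) + Polynomial.C (a : ℂ) * Polynomial.X +
    Polynomial.C (Complex.I * b₂) * Polynomial.X ^ 2 +
    Polynomial.C (Complex.I * b₄) * Polynomial.X ^ 4

/-- A primitive of the logarithmic field of `quartic a b₀ b₂ b₄`. -/
noncomputable def quarticPrimitive (a b₀ b₂ b₄ : ℝ) (w : ℂ) : ℂ :=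
  a * w + Complex.I * (-b₀ * Complex.exp (-w) + b₂ * Complex.exp w +
    b₄ * (Complex.exp w ^ 3 / 3))

theorem natDegree_quartic {a b₀ b₂ b₄ : ℝ} (h : b₄ ≠ 0) : (quartic a b₀ b₂ b₄).natDegree = 4 := by
  unfold quartic
  have : Complex.I * (b₄ : ℂ) ≠ 0 := mul_ne_zero Complex.I_ne_zero (by exact_mod_cast h)
  compute_degree!

theorem hasDerivAt_quarticPrimitive (a b₀ b₂ b₄ : ℝ) (w : ℂ) :
    HasDerivAt (quarticPrimitive a b₀ b₂ b₄) (logField (quartic a b₀ b₂ b₄) w) w := by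
  have h1 := (hasDerivAt_id w).const_mul (a : ℂ)
  have h2 := ((hasDerivAt_neg w).cexp).const_mul (-b₀ : ℂ)
  have h3 := (Complex.hasDerivAt_exp w).const_mul (b₂ : ℂ)
  have h4 := (((Complex.hasDerivAt_exp w).pow 3).div_const 3).const_mul (b₄ : ℂ)
  have h5 := h1.add (((h2.add h3).add h4).const_mul Complex.I)
  refine h5.congr_deriv ?_
  have h6 : Complex.exp (-w) * Complex.exp w = 1 := by rw [← Complex.exp_add]; simp
  simp only [logField, quartic, Polynomial.eval_add, Polynomial.eval_mul, Polynomial.eval_C,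
    Polynomial.eval_X, Polynomial.eval_pow]
  norm_num
  linear_combination (-(a : ℂ) - Complex.I * b₂ * Complex.exp w -
    Complex.I * b₄ * Complex.exp w ^ 3) * h6

/-- The abscissa of the intersection of the circle of radius `exp x` with the line `Im z = 1` in the
right half-plane. -/
noncomputable def crossingAbscissa (x : ℝ) : ℝ := √(Real.exp (2 * x) - 1)

theorem exp_cutPoint {x : ℝ} (hx : 0 < x) :
    Complex.exp (cutPoint 0 x) = crossingAbscissa x + Complex.I ∧
    Complex.exp (cutPoint 1 x) = -crossingAbscissa x + Complex.I ∧
    Complex.exp (cutPoint 2 x) = -crossingAbscissa x - Complex.I ∧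
    Complex.exp (cutPoint 3 x) = crossingAbscissa x - Complex.I ∧
    Complex.exp (cutPoint 4 x) = crossingAbscissa x + Complex.I := by
  set α := Real.arcsin (Real.exp (-x)) with hα
  have hα0 : 0 < α := arcsin_exp_neg_pos _
  have hα1 : α < Real.pi / 2 := arcsin_exp_neg_lt hx
  have hsin : Real.exp x * Real.sin α = 1 := by
    rw [hα, Real.sin_arcsin (by linarith [Real.exp_pos (-x)]) (by simpa using hx.le),
      ← Real.exp_add]
    simp
  have hcos : Real.exp x * Real.cos α = crossingAbscissa x := by
    symm
    rw [crossingAbscissa, Real.sqrt_eq_iff_mul_self_eq_of_pos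
      (mul_pos (Real.exp_pos _) (Real.cos_pos_of_mem_Ioo ⟨by linarith, hα1⟩))]
    rw [two_mul, Real.exp_add]
    linear_combination (Real.exp x) ^ 2 * Real.sin_sq_add_cos_sq α -
      (Real.exp x * Real.sin α + 1) * hsin
  have key : ∀ j : ℕ, Complex.exp (cutPoint j x) =
      (Real.exp x * Real.cos (cut j x) : ℝ) +
        (Real.exp x * Real.sin (cut j x) : ℝ) * Complex.I := by
    intro j
    apply Complex.ext
    · rw [Complex.exp_re]
      simp only [Complex.add_re, Complex.ofReal_re, Complex.re_ofReal_mul, Complex.I_re, mul_zero,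
        add_zero]
      rfl
    · rw [Complex.exp_im]
      simp only [Complex.add_im, Complex.ofReal_im, Complex.im_ofReal_mul, Complex.I_im, mul_one,
        zero_add]
      rfl
  refine ⟨?_, ?_, ?_, ?_, ?_⟩ <;> rw [key] <;> simp only [cut, ← hα]
  · rw [hcos, hsin]; simp
  · rw [Real.cos_pi_sub, Real.sin_pi_sub, mul_neg, hcos, hsin]; simp
  · rw [add_comm Real.pi, Real.cos_add_pi, Real.sin_add_pi, mul_neg, mul_neg, hcos, hsin]
    simp [sub_eq_add_neg]
  · rw [Real.cos_two_pi_sub, Real.sin_two_pi_sub, mul_neg, hcos, hsin]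
    simp [sub_eq_add_neg]
  · rw [add_comm (2 * Real.pi), Real.cos_add_two_pi, Real.sin_add_two_pi, hcos, hsin]
    simp

theorem im_quarticPrimitive {a b₀ b₂ b₄ : ℝ} {w : ℂ} {u v : ℝ} (hv : v ^ 2 = 1)
    (hw : Complex.exp w = u + v * Complex.I) :
    (quarticPrimitive a b₀ b₂ b₄ w).im =
      a * w.im - b₀ * (u / (1 + u ^ 2)) + b₂ * u + b₄ * ((u ^ 3 - 3 * u) / 3) := by
  have h1 : (Complex.exp (-w)).re = u / (1 + u ^ 2) := by
    rw [Complex.exp_neg, hw, Complex.inv_re]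
    simp only [Complex.normSq_apply]
    simp
    congr 1
    linear_combination hv
  have h2 : (Complex.exp w).re = u := by simp [hw]
  have h3 : (Complex.exp w ^ 3).re = u ^ 3 - 3 * u := by
    rw [hw]
    have : ((u : ℂ) + v * Complex.I) ^ 3 =
        ((u ^ 3 - 3 * u * v ^ 2 : ℝ) : ℂ) + ((3 * u ^ 2 * v - v ^ 3 : ℝ) : ℂ) * Complex.I := by
      push_cast
      linear_combination (3 * (u : ℂ) * v ^ 2 + v ^ 3 * Complex.I) * Complex.I_sq
    rw [this, hv]
    simp only [Complex.add_re, Complex.ofReal_re, Complex.re_ofReal_mul, Complex.I_re, mul_zero,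
      add_zero, mul_one]
  have h4 : (Complex.exp w ^ 3 / 3).re = (u ^ 3 - 3 * u) / 3 := by
    rw [show (3 : ℂ) = ((3 : ℝ) : ℂ) by norm_num, Complex.div_ofReal_re, h3]
  have h5 : (quarticPrimitive a b₀ b₂ b₄ w).im = a * w.im + (-b₀ * (Complex.exp (-w)).re +
      b₂ * (Complex.exp w).re + b₄ * (Complex.exp w ^ 3 / 3).re) := by
    simp only [quarticPrimitive, Complex.add_im, Complex.I_mul_im, Complex.add_re,
      Complex.re_ofReal_mul, Complex.im_ofReal_mul]
    rw [← Complex.ofReal_neg, Complex.re_ofReal_mul]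
  rw [h5, h1, h2, h4]
  ring

/-- The perturbation whose Melnikov function, in terms of the abscissa `X` of the crossing, is
`2 (X + 13) (X - 1) (X - 2) (2 X - 9) (2 X - 11) / (1 + X ^ 2)`. The linear, constant and
quadratic terms contribute multiples of `1`, `X / (1 + X ^ 2)` and `X`, and the quartic terms
`X ^ 3` up to a multiple of `X`; so the numerator can be any quintic in which `X ^ 4` does not occur
and `X ^ 2` and `1` have the same coefficient. The five roots are chosen to fit these two
conditions. -/
noncomputable def fourCyclePerturbation : Zone → Polynomial ℂ
  | .plus => quartic (2574 / Real.pi) (-4250) 0 (-6)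
  | .center => quartic (2574 / Real.pi) 0 0 1
  | .minus => quartic (2574 / Real.pi) 0 (-441) 6

/-- Primitives of the logarithmic fields of `fourCyclePerturbation`. -/
noncomputable def fourCyclePrimitive : Zone → ℂ → ℂ
  | .plus => quarticPrimitive (2574 / Real.pi) (-4250) 0 (-6)
  | .center => quarticPrimitive (2574 / Real.pi) 0 0 1
  | .minus => quarticPrimitive (2574 / Real.pi) 0 (-441) 6

theorem hasDerivAt_fourCyclePrimitive (σ : Zone) (w : ℂ) :
    HasDerivAt (fourCyclePrimitive σ) (logField (fourCyclePerturbation σ) w) w := by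
  cases σ <;> exact hasDerivAt_quarticPrimitive _ _ _ _ w

theorem natDegree_fourCyclePerturbation (σ : Zone) : (fourCyclePerturbation σ).natDegree = 4 := by
  cases σ <;> exact natDegree_quartic (by norm_num)

theorem melnikov_fourCyclePrimitive {x : ℝ} (hx : 0 < x) :
    melnikov fourCyclePrimitive x =
      5148 - 8500 * (crossingAbscissa x / (1 + crossingAbscissa x ^ 2)) - 906 * crossingAbscissa x +
        8 * crossingAbscissa x ^ 3 := by
  obtain ⟨h0, h1, h2, h3, h4⟩ := exp_cutPoint hx
  set X := crossingAbscissa x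
  have e0 : Complex.exp (cutPoint 0 x) = (X : ℝ) + (1 : ℝ) * Complex.I := by rw [h0]; simp
  have e1 : Complex.exp (cutPoint 1 x) = (-X : ℝ) + (1 : ℝ) * Complex.I := by rw [h1]; simp
  have e2 : Complex.exp (cutPoint 2 x) = (-X : ℝ) + (-1 : ℝ) * Complex.I := by
    rw [h2]; simp [sub_eq_add_neg]
  have e3 : Complex.exp (cutPoint 3 x) = (X : ℝ) + (-1 : ℝ) * Complex.I := by
    rw [h3]; simp [sub_eq_add_neg]
  have e4 : Complex.exp (cutPoint 4 x) = (X : ℝ) + (1 : ℝ) * Complex.I := by rw [h4]; simp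
  have hp : (1 : ℝ) ^ 2 = 1 := by norm_num
  have hn : (-1 : ℝ) ^ 2 = 1 := by norm_num
  have hpi := Real.pi_ne_zero
  simp only [melnikov, Finset.sum_range_succ, Finset.sum_range_zero, zoneAt, fourCyclePrimitive,
    zero_add, Nat.reduceAdd]
  rw [im_quarticPrimitive hp e0, im_quarticPrimitive hp e1, im_quarticPrimitive hp e1,
    im_quarticPrimitive hn e2, im_quarticPrimitive hn e2, im_quarticPrimitive hn e3,
    im_quarticPrimitive hn e3, im_quarticPrimitive hp e4]
  simp only [cutPoint, cut]
  have hX : 1 + X ^ 2 ≠ 0 := by positivity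
  rw [neg_sq]
  field_simp
  ring

theorem hasDerivAt_crossingAbscissa {x : ℝ} (hx : 0 < x) :
    HasDerivAt crossingAbscissa (Real.exp (2 * x) / crossingAbscissa x) x := by
  have hpos : 0 < Real.exp (2 * x) - 1 := by
    linarith [Real.one_lt_exp_iff.2 (by linarith : 0 < 2 * x)]
  have h1 : HasDerivAt (fun x : ℝ => Real.exp (2 * x) - 1) (Real.exp (2 * x) * (2 * 1)) x :=
    (((hasDerivAt_id x).const_mul 2).exp).sub_const 1
  refine (h1.sqrt hpos.ne').congr_deriv ?_
  have h2 : crossingAbscissa x ≠ 0 := (Real.sqrt_pos.2 hpos).ne'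
  change Real.exp (2 * x) * (2 * 1) / (2 * crossingAbscissa x) = _
  field_simp

/-- The radii of the circles from which limit cycles of `fourCyclePerturbation` bifurcate are
`√(1 + X ^ 2)` for these abscissae `X`. -/
noncomputable def cycleAbscissa : Fin 4 → ℝ := ![1, 2, 9 / 2, 11 / 2]

theorem cycleAbscissa_pos (k : Fin 4) : 0 < cycleAbscissa k := by
  fin_cases k <;> simp [cycleAbscissa]

theorem strictMono_cycleAbscissa : StrictMono cycleAbscissa := by
  refine Fin.strictMono_iff_lt_succ.2 fun k => ?_
  fin_cases k <;> simp [cycleAbscissa] <;> norm_num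

theorem exists_melnikov_simple_zero (k : Fin 4) :
    ∃ m : ℝ, m ≠ 0 ∧ melnikov fourCyclePrimitive (Real.log √(1 + cycleAbscissa k ^ 2)) = 0 ∧
      HasDerivAt (melnikov fourCyclePrimitive) m (Real.log √(1 + cycleAbscissa k ^ 2)) := by
  set X := cycleAbscissa k with hX
  have hX0 : 0 < X := cycleAbscissa_pos k
  set p := Real.log √(1 + X ^ 2) with hp
  have hp' : p = Real.log (1 + X ^ 2) / 2 := Real.log_sqrt (by positivity)
  have hp0 : 0 < p := by
    rw [hp']
    have := Real.log_pos (show 1 < 1 + X ^ 2 by nlinarith)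
    linarith
  have hexp : Real.exp (2 * p) = 1 + X ^ 2 := by
    rw [hp', mul_div_cancel₀ _ two_ne_zero, Real.exp_log (by positivity)]
  have habs : crossingAbscissa p = X := by
    rw [crossingAbscissa, hexp, add_sub_cancel_left, Real.sqrt_sq hX0.le]
  have hd := hasDerivAt_crossingAbscissa hp0
  have hden : 1 + crossingAbscissa p ^ 2 ≠ 0 := by positivity
  have hderiv := ((((hd.div ((hd.pow 2).const_add 1) hden).const_mul 8500).const_sub 5148).sub
    (hd.const_mul 906)).add ((hd.pow 3).const_mul 8)
  refine ⟨_, ?_, ?_, hderiv.congr_of_eventuallyEq ?_⟩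
  · rw [Pi.pow_apply, hexp, habs, hX]
    fin_cases k <;> norm_num [cycleAbscissa]
  · rw [melnikov_fourCyclePrimitive hp0, habs, hX]
    fin_cases k <;> norm_num [cycleAbscissa]
  · filter_upwards [Ioi_mem_nhds hp0] with x hx
    exact melnikov_fourCyclePrimitive hx

/-! ### Hausdorff convergence and the four limit cycles -/

/-- A set that lies in a thin annulus about a circle and meets every ray is close to the circle in
the Hausdorff distance. -/
theorem hausdorffEDist_sphere_le {Γ : Set ℂ} {r d : ℝ} (hr : 0 < r)
    (hnear : ∀ z ∈ Γ, |Real.log ‖z‖ - Real.log r| ≤ d) (hne : ∀ z ∈ Γ, z ≠ 0)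
    (hray : ∀ θ : ℝ, ∃ z ∈ Γ, z = ‖z‖ * Complex.exp (θ * Complex.I)) :
    Metric.hausdorffEDist Γ (Metric.sphere (0 : ℂ) r) ≤ ENNReal.ofReal (r * (Real.exp d - 1)) := by
  have hnorm : ∀ z ∈ Γ, |‖z‖ - r| ≤ r * (Real.exp d - 1) := by
    intro z hz
    have hz0 : 0 < ‖z‖ := norm_pos_iff.2 (hne z hz)
    have h1 := abs_le.1 (hnear z hz)
    have h2 : ‖z‖ ≤ r * Real.exp d := by
      rw [← Real.exp_log hz0]
      nth_rewrite 1 [← Real.exp_log hr]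
      rw [← Real.exp_add, Real.exp_le_exp]
      linarith [h1.2]
    have h3 : r * Real.exp (-d) ≤ ‖z‖ := by
      rw [← Real.exp_log hz0]
      nth_rewrite 1 [← Real.exp_log hr]
      rw [← Real.exp_add, Real.exp_le_exp]
      linarith [h1.1]
    have h4 : 2 ≤ Real.exp d + Real.exp (-d) := by
      have := Real.add_one_le_exp d
      have := Real.add_one_le_exp (-d)
      linarith
    exact abs_le.2 ⟨by nlinarith, by linarith⟩
  refine Metric.hausdorffEDist_le_of_mem_edist (fun z hz => ?_) (fun y hy => ?_)
  · have hz0 : (‖z‖ : ℂ) ≠ 0 := by exact_mod_cast (norm_pos_iff.2 (hne z hz)).ne'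
    have hz0' := (norm_pos_iff.2 (hne z hz)).ne'
    refine ⟨(r / ‖z‖ : ℝ) * z, ?_, ?_⟩
    · rw [mem_sphere_zero_iff_norm, norm_mul, Complex.norm_real, Real.norm_eq_abs, abs_div,
        abs_norm, abs_of_pos hr, div_mul_cancel₀ _ hz0']
    · rw [edist_dist]
      refine ENNReal.ofReal_le_ofReal ((le_of_eq ?_).trans (hnorm z hz))
      rw [dist_eq_norm, show z - (r / ‖z‖ : ℝ) * z = ((1 - r / ‖z‖ : ℝ) : ℂ) * z by
        push_cast; ring, norm_mul, Complex.norm_real, Real.norm_eq_abs]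
      nth_rewrite 2 [← abs_norm z]
      rw [← abs_mul]
      congr 1
      field_simp
  · obtain ⟨z, hz, hzray⟩ := hray y.arg
    refine ⟨z, hz, ?_⟩
    rw [edist_dist]
    refine ENNReal.ofReal_le_ofReal ((le_of_eq ?_).trans (hnorm z hz))
    rw [mem_sphere_zero_iff_norm] at hy
    have hy' : y = (r : ℂ) * Complex.exp (y.arg * Complex.I) := by
      rw [← hy, Complex.norm_mul_exp_arg_mul_I]
    rw [dist_comm, dist_eq_norm]
    conv_lhs => rw [hzray]
    nth_rewrite 2 [hy']
    rw [← sub_mul, norm_mul, Complex.norm_exp_ofReal_mul_I, mul_one, ← Complex.ofReal_sub,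
      Complex.norm_real, Real.norm_eq_abs]

theorem theoremA :
    ∃ h : Zone → Polynomial ℂ, (∀ σ, (h σ).natDegree = 4) ∧
      ∃ r : Fin 4 → ℝ, StrictMono r ∧ (∀ k, 1 < r k) ∧
        ∃ ε₀ : ℝ, 0 < ε₀ ∧ ∃ Γ : ℝ → Fin 4 → Set ℂ,
          (∀ ε : ℝ, 0 < |ε| → |ε| < ε₀ →
            Function.Injective (Γ ε) ∧
              ∀ k, IsLimitCycle (filippov (perturbedCenter h ε)) (Γ ε k)) ∧
          ∀ k, Filter.Tendsto
            (fun ε : ℝ => Metric.hausdorffEDist (Γ ε k) (Metric.sphere (0 : ℂ) (r k)))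
            (nhdsWithin 0 {0}ᶜ) (nhds 0) := by
  set r : Fin 4 → ℝ := fun k => √(1 + cycleAbscissa k ^ 2) with hr
  have hr1 : ∀ k, 1 < r k := by
    intro k
    have := cycleAbscissa_pos k
    rw [hr, Real.lt_sqrt zero_le_one]
    nlinarith
  have hmono : StrictMono r := by
    intro k l hkl
    have h1 := strictMono_cycleAbscissa hkl
    have h2 := cycleAbscissa_pos k
    exact Real.sqrt_lt_sqrt (by positivity) (by nlinarith)
  have hr0 : ∀ k, 0 < r k := fun k => one_pos.trans (hr1 k)
  choose m hm hzero hderiv using exists_melnikov_simple_zero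
  choose c hc using fun k => exists_isLimitCycle_of_simple_zero hasDerivAt_fourCyclePrimitive
    (Real.log_pos (hr1 k)) (hm k) (hzero k) (hderiv k)
  set P : ℝ → Fin 4 → Set ℂ → Prop := fun ε k Γ =>
    IsLimitCycle (filippov (perturbedCenter fourCyclePerturbation ε)) Γ ∧
      (∀ z ∈ Γ, |Real.log ‖z‖ - Real.log (r k)| ≤ c k * |ε|) ∧
      ∀ θ : ℝ, ∃ z ∈ Γ, z = ‖z‖ * Complex.exp (θ * Complex.I) with hP
  set Γ : ℝ → Fin 4 → Set ℂ := fun ε k => Classical.epsilon (P ε k) with hΓ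
  have hall : ∀ᶠ ε : ℝ in 𝓝[≠] 0, ∀ k, P ε k (Γ ε k) := by
    filter_upwards [eventually_all.2 hc] with ε hε k
    exact Classical.epsilon_spec (hε k)
  -- Annuli of width `O(ε)` about different circles are disjoint for small `ε`.
  have hsep : ∀ᶠ ε : ℝ in 𝓝[≠] 0, ∀ k l, k ≠ l →
      (c k + c l) * |ε| < |Real.log (r k) - Real.log (r l)| := by
    refine eventually_all.2 fun k => eventually_all.2 fun l => ?_
    by_cases hkl : k = l
    · exact Eventually.of_forall fun ε h => absurd hkl h
    · have hne : Real.log (r k) ≠ Real.log (r l) := fun h =>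
        hkl (hmono.injective (Real.log_injOn_pos (hr0 k) (hr0 l) h))
      filter_upwards [nhdsWithin_le_nhds
        (eventually_mul_abs_lt (c k + c l) (abs_pos.2 (sub_ne_zero.2 hne)))] with ε hε _
      exact hε
  obtain ⟨ε₀, hε₀, hgood⟩ := Metric.eventually_nhds_iff.1
    (eventually_nhdsWithin_iff.1 (hall.and hsep))
  refine ⟨fourCyclePerturbation, natDegree_fourCyclePerturbation, r, hmono, hr1, ε₀, hε₀, Γ,
    fun ε h0 hlt => ?_, fun k => ?_⟩
  · obtain ⟨h1, h2⟩ := hgood (y := ε) (by simpa [Real.dist_eq] using hlt) (abs_pos.1 h0)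
    refine ⟨fun k l hkl => ?_, fun k => (h1 k).1⟩
    by_contra hne
    obtain ⟨z, hz, -⟩ := (h1 k).2.2 0
    have e1 := (h1 k).2.1 z hz
    have e2 := (h1 l).2.1 z (hkl ▸ hz)
    have e3 := h2 k l hne
    have e4 := abs_sub_le (Real.log (r k)) (Real.log ‖z‖) (Real.log (r l))
    rw [abs_sub_comm] at e1
    linarith
  · have hbound : ∀ᶠ ε : ℝ in 𝓝[≠] 0,
        Metric.hausdorffEDist (Γ ε k) (Metric.sphere (0 : ℂ) (r k)) ≤
          ENNReal.ofReal (r k * (Real.exp (c k * |ε|) - 1)) := by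
      -- Closeness of logarithms says nothing at the origin, where `log 0 = 0`, so it is excluded.
      have hsmall := eventually_mul_abs_lt (c k) (Real.log_pos (hr1 k))
      filter_upwards [hall, nhdsWithin_le_nhds hsmall] with ε hε hs
      refine hausdorffEDist_sphere_le (hr0 k) (hε k).2.1 (fun z hz h0 => ?_) (hε k).2.2
      have := (hε k).2.1 z hz
      rw [h0, norm_zero, Real.log_zero, zero_sub, abs_neg,
        abs_of_pos (Real.log_pos (hr1 k))] at this
      linarith
    refine tendsto_of_tendsto_of_tendsto_of_le_of_le' tendsto_const_nhds ?_
      (Eventually.of_forall fun _ => zero_le) hbound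
    have hcont : Continuous fun ε : ℝ => ENNReal.ofReal (r k * (Real.exp (c k * |ε|) - 1)) :=
      ENNReal.continuous_ofReal.comp (by fun_prop)
    have h0 := hcont.tendsto 0
    simp only [abs_zero, mul_zero, Real.exp_zero, sub_self, ENNReal.ofReal_zero] at h0
    exact h0.mono_left nhdsWithin_le_nhds
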